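/- Conventions. Lorentz metrics have signature $(-,+,\dots,+)$; gamma matrices satisfy $\Gamma_a\Gamma_b+\Gamma_b\Gamma_a=2\eta_{ab}\mathrm{Id}$ on $\Delta=\mathbb C^{32}$. In an orthonormal frame $e_a$, vectors and $k$-forms act on spinors by $X\cdot\psi=X^a\Gamma_a\psi$ and $F\cdot\psi=\frac1{k!}\sum F_{a_1\dots a_k}\Gamma^{a_1\dots a_k}\psi$. The covariant derivative of spinors induced by the Levi-Civita connection is $\nabla_X\psi=d\psi(X)-\frac14\omega_{ab}(X)\Gamma^{ab}\psi$ with $\omega_{ab}(X)=g(\nabla_Xe_a,e_b)$. Let $N$ be a smooth $10$-manifold with a Lorentz metric $g$ and an (orthochronous) spin structure with complex spinor bundle $S^N$, and put $\Gamma_{11}=\Gamma_0\Gamma_1\cdots\Gamma_9$. Let $\phi$ be a smooth function and $C_1,B_2,C_3$ smooth forms of degree $1,2,3$ on $N$, with $G_2=dC_1$, $H_3=dB_2$, $\tilde G_4=dC_3-C_1\wedge H_3$. Let $\alpha$ be the volume form of a rotation-invariant metric on $S^1$, and $S$ the vector field on $S^1$ with $\alpha(S)=1$. On $M=N\times S^1$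 consider the Lorentz metric $$g_M=e^{-2\phi/3}\,\pi_N^*g+e^{4\phi/3}(\pi_{S^1}^*\alpha-\pi_N^*C_1)\otimes(\pi_{S^1}^*\alpha-\pi_N^*C_1),$$ the $3$-form $C=\pi_N^*C_3+\pi_N^*B_2\wedge\pi_{S^1}^*\alpha$ and $G=dC$. For a local orthonormal frame $e_0,\dots,e_9$ of $N$ (in the spin structure) let $$e'_a=e^{\phi/3}(\bar e_a+C_1(e_a)\bar S)\ (0\le a\le 9),\qquad e'_{10}=e^{-2\phi/3}\bar S,$$ where a bar denotes the lift to the corresponding factor of $M$; this is an orthonormal frame of $g_M$. Let $S^M=\pi_N^*S^N$, with Clifford multiplication given in this frame by $\Gamma'_a=\Gamma_a$ and $\Gamma'_{10}=\Gamma_{11}$. Let $\delta$ be a smooth section of $S^N$, let $\bar\delta$ be its pull-back to $M$, and put $\varepsilon=e^{\phi/6}\delta$. For a tangent vector $X$ of $M$ consider the gravitino Killing spinor equation of eleven-dimensional supergravity $$\nabla^M_X\bar\delta+\tfrac1{24}\bigl(3G\cdot(X\cdot\bar\delta)-X\cdot(G\cdot\bar\delta)\bigr)=0.\qquad(\ast)$$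 Then: 1. At every point, $(\ast)$ for $X=e'_{10}$ is equivalent to the type IIA dilatino Killing spinor equation $$\Bigl(\tfrac14e^{\phi}G_2-\tfrac13d\phi\,\Gamma_{11}+\tfrac1{12}e^{\phi}\tilde G_4\Gamma_{11}+\tfrac16H_3\Bigr)\cdot\varepsilon=0.$$ 2. At every point where the dilatino equation holds, and for every $0\le a\le 9$, $(\ast)$ for $X=e'_a$ is equivalent to the type IIA gravitino Killing spinor equation $$\nabla_X\varepsilon-\tfrac14(i_XH_3)\cdot\Gamma_{11}\varepsilon+\tfrac18e^{\phi}\bigl(\tilde G_4\cdot(X\cdot\varepsilon)+G_2\cdot(X\cdot\Gamma_{11}\varepsilon)\bigr)=0$$ for $X=e_a$. 3. Hence $\bar\delta$ satisfies $(\ast)$ for all tangent vectors $X$ of $M$ if and only if $\varepsilon$ satisfies the dilatino equation everywhere on $N$ and the gravitino equation for all tangent vectors $X$ of $N$. 4. Consequently, for every $Spin(10,1)$-equivariant real structure on $\Delta$ (defining Majorana spinors), there is a non-zero Majorana spinor $\delta$ on $N$ whose pull-back satisfies $(\ast)$ for all $X$ if and only if there is a non-zero Majorana spinor $\varepsilon$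 on $N$ satisfying both type IIA equations. -/

import Mathlib

open scoped Manifold ContDiff Bundle Matrix

noncomputable section

namespace IIA

/-! ### Gamma matrices and the spin group -/

/-- Complex `32 × 32` matrices, acting on Dirac spinors in dimensions ten and eleven. -/
abbrev Mat : Type := Matrix (Fin 32) (Fin 32) ℂ

/-- The space of Dirac spinors in dimensions ten and eleven. -/
abbrev Spinor : Type := Fin 32 → ℂ

/-- The diagonal entries of the Minkowski metric `(-,+,…,+)` on `ℝ^{n+1}`. -/
def eta {n : ℕ} (a : Fin (n + 1)) : ℝ := if a = 0 then -1 else 1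

/-- The Minkowski quadratic form on `ℝ^{n+1}`. -/
def minkowski (n : ℕ) : QuadraticForm ℝ (Fin (n + 1) → ℝ) :=
  QuadraticMap.weightedSumSquares ℝ (eta (n := n))

/-- (Physical) gamma matrices: `Γ_a Γ_b + Γ_b Γ_a = 2 η_{ab} Id`. -/
structure GammaMatrices (n : ℕ) where
  toFun : Fin (n + 1) → Mat
  clifford : ∀ a b, toFun a * toFun b + toFun b * toFun a =
    (if a = b then 2 * eta a else 0 : ℝ) • (1 : Mat)

instance (n : ℕ) : CoeFun (GammaMatrices n) (fun _ => Fin (n + 1) → Mat) := ⟨GammaMatrices.toFun⟩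

namespace GammaMatrices

variable {n : ℕ} (Γ : GammaMatrices n)

theorem sq_vector (v : Fin (n + 1) → ℝ) :
    Fintype.linearCombination ℝ Γ.toFun v * Fintype.linearCombination ℝ Γ.toFun v =
      algebraMap ℝ Mat (minkowski n v) := by
  have h2 : (2 : ℝ) • (Fintype.linearCombination ℝ Γ.toFun v *
      Fintype.linearCombination ℝ Γ.toFun v) = (2 : ℝ) • algebraMap ℝ Mat (minkowski n v) := by
    have h1 : ∑ a, ∑ b, (v a • Γ.toFun a) * (v b • Γ.toFun b) =
        ∑ a, ∑ b, (v b • Γ.toFun b) * (v a • Γ.toFun a) := Finset.sum_comm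
    have h3 : ∀ a b, (v a • Γ.toFun a) * (v b • Γ.toFun b) +
        (v b • Γ.toFun b) * (v a • Γ.toFun a) =
          (v a * v b * (if a = b then 2 * eta a else 0 : ℝ)) • (1 : Mat) := by
      intro a b
      rw [smul_mul_smul_comm, smul_mul_smul_comm, mul_comm (v b), ← smul_add, Γ.clifford,
        smul_smul]
    rw [two_smul]
    simp only [Fintype.linearCombination_apply, Finset.sum_mul_sum]
    nth_rewrite 2 [h1]
    simp only [← Finset.sum_add_distrib, h3, ← Finset.sum_smul]
    rw [Algebra.algebraMap_eq_smul_one, smul_smul, minkowski,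
      QuadraticMap.weightedSumSquares_apply, Finset.mul_sum]
    congr 1
    refine Finset.sum_congr rfl fun a _ => ?_
    simp only [mul_ite, mul_zero, Finset.sum_ite_eq, Finset.mem_univ, if_true, smul_eq_mul]
    ring
  exact (smul_right_injective Mat (two_ne_zero (α := ℝ))) h2

/-- The representation of the Clifford algebra of Minkowski space given by gamma matrices. -/
def rep : CliffordAlgebra (minkowski n) →ₐ[ℝ] Mat :=
  CliffordAlgebra.lift (minkowski n) ⟨Fintype.linearCombination ℝ Γ.toFun, Γ.sq_vector⟩

/-- The image of the orthochronous spin group `Spin(n,1)` under the Dirac representation.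
(Mathlib's `spinGroup` consists of the even products of vectors of total spinor norm `+1`; for
signature `(n,1)` this is the double cover of `SO⁺(n,1)`.) -/
def spin : Submonoid Mat := (spinGroup (minkowski n)).map Γ.rep.toMonoidHom

/-- Antisymmetrised products with raised indices, `Γ^{a₁…a_k}`. -/
def up {k : ℕ} (a : Fin k → Fin (n + 1)) : Mat :=
  ((k.factorial : ℝ)⁻¹) • ∑ s : Equiv.Perm (Fin k),
    (Equiv.Perm.sign s : ℤ) • (List.ofFn fun j => eta (a (s j)) • Γ (a (s j))).prod

/-- Clifford multiplication by a `k`-form on a vector space with orthonormal basis `e`: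
`F · ψ = (1/k!) ∑ F(e_{a₁},…,e_{a_k}) Γ^{a₁…a_k} ψ`. -/
def form {V : Type*} [AddCommGroup V] [Module ℝ V] {k : ℕ} (e : Fin (n + 1) → V)
    (F : V [⋀^Fin k]→ₗ[ℝ] ℝ) : Mat :=
  ((k.factorial : ℝ)⁻¹) • ∑ a : Fin k → Fin (n + 1), F (fun j => e (a j)) • Γ.up a

/-- Sign in `Γ_a Γ_b = ± Γ_b Γ_a`. -/
def sgn (a b : Fin (n + 1)) : ℤ := if a = b then 1 else -1

theorem mul_comm_sgn (a b : Fin (n + 1)) : Γ a * Γ b = sgn a b • (Γ b * Γ a) := by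
  have h := Γ.clifford a b
  unfold sgn
  split_ifs at h ⊢ with hab
  · subst hab; simp
  · rw [zero_smul] at h; simpa using eq_neg_of_add_eq_zero_left h

theorem mul_self (a : Fin (n + 1)) : Γ a * Γ a = eta a • (1 : Mat) := by
  have h := Γ.clifford a a
  rw [if_pos rfl, ← two_smul ℝ, mul_smul] at h
  exact (smul_right_injective Mat (two_ne_zero (α := ℝ))) h

theorem mul_prod (a : Fin (n + 1)) (l : List (Fin (n + 1))) :
    Γ a * (l.map Γ).prod = (l.map (sgn a)).prod • ((l.map Γ).prod * Γ a) := by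
  induction l with
  | nil => simp
  | cons b l ih =>
    simp only [List.map_cons, List.prod_cons]
    rw [← mul_assoc, Γ.mul_comm_sgn a b, smul_mul_assoc, mul_assoc, ih, mul_smul_comm, smul_smul,
      mul_assoc]

/-- The chirality operator `Γ₁₁ = Γ₀ Γ₁ ⋯ Γ₉`. -/
def chirality (Γ : GammaMatrices 9) : Mat := (List.ofFn fun a : Fin 10 => Γ a).prod

theorem chirality_anticomm (Γ : GammaMatrices 9) (a : Fin 10) :
    Γ a * Γ.chirality = -(Γ.chirality * Γ a) := by
  have h := Γ.mul_prod a (List.finRange 10)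
  have hs : ∀ a : Fin 10, ((List.finRange 10).map (sgn (n := 9) a)).prod = -1 := by decide
  rw [hs a, neg_one_smul] at h
  rwa [chirality, List.ofFn_eq_map]

/-- The sign of the square of a product of gamma matrices. -/
def sqSign : List (Fin (n + 1)) → ℤ
  | [] => 1
  | b :: l => (l.map (sgn b)).prod * (if b = 0 then -1 else 1) * sqSign l

theorem prod_sq (l : List (Fin (n + 1))) :
    (l.map Γ).prod * (l.map Γ).prod = sqSign l • (1 : Mat) := by
  induction l with
  | nil => simp [sqSign]
  | cons b l ih =>
    have hs : (l.map (sgn b)).prod * (l.map (sgn b)).prod = 1 := by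
      clear ih
      induction l with
      | nil => simp
      | cons d l ih =>
        have hd : sgn b d * sgn b d = 1 := by unfold sgn; split_ifs <;> rfl
        simp only [List.map_cons, List.prod_cons]
        rw [mul_mul_mul_comm, hd, ih, one_mul]
    have hc : (l.map Γ).prod * Γ b = (l.map (sgn b)).prod • (Γ b * (l.map Γ).prod) := by
      rw [Γ.mul_prod b l, smul_smul, hs, one_smul]
    have hb : Γ b * Γ b = (if b = 0 then -1 else 1 : ℤ) • (1 : Mat) := by
      rw [Γ.mul_self]; unfold eta; split_ifs <;> simp
    simp only [List.map_cons, List.prod_cons, sqSign]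
    rw [mul_assoc, ← mul_assoc (l.map Γ).prod (Γ b), hc, smul_mul_assoc, mul_assoc, ih,
      mul_smul_comm, ← mul_assoc, hb, mul_smul_comm, mul_one, smul_smul, smul_smul]
    congr 1
    ring

theorem chirality_sq (Γ : GammaMatrices 9) : Γ.chirality * Γ.chirality = 1 := by
  have h := Γ.prod_sq (List.finRange 10)
  have hs : sqSign (n := 9) (List.finRange 10) = 1 := by decide
  rw [hs, one_smul] at h
  rwa [chirality, List.ofFn_eq_map]

/-- The gamma matrices in dimension eleven: `Γ₀,…,Γ₉` together with `Γ'₁₀ = Γ₁₁`. Their product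
`Γ'₀ ⋯ Γ'₁₀` is the identity. -/
def extend (Γ : GammaMatrices 9) : GammaMatrices 10 where
  toFun := Fin.snoc (α := fun _ => Mat) (fun a : Fin 10 => Γ a) Γ.chirality
  clifford a b := by
    induction a using Fin.lastCases with
    | last =>
      induction b using Fin.lastCases with
      | last =>
        have he : eta (Fin.last 10) = 1 := if_neg (Fin.last_pos).ne'
        simp only [Fin.snoc_last, chirality_sq, he, if_true, mul_one, two_smul]
      | cast b =>
        have hne : Fin.last 10 ≠ Fin.castSucc b := (Fin.castSucc_lt_last b).ne'
        simp only [Fin.snoc_last, Fin.snoc_castSucc, Γ.chirality_anticomm, if_neg hne, zero_smul,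
          add_neg_cancel]
    | cast a =>
      induction b using Fin.lastCases with
      | last =>
        have hne : Fin.castSucc a ≠ Fin.last 10 := (Fin.castSucc_lt_last a).ne
        simp only [Fin.snoc_last, Fin.snoc_castSucc, Γ.chirality_anticomm, if_neg hne, zero_smul,
          neg_add_cancel]
      | cast b =>
        have he : eta (n := 10) (Fin.castSucc a) = eta (n := 9) a := by
          simp [eta]
        simp only [Fin.snoc_castSucc, Γ.clifford, Fin.castSucc_inj, he]

theorem extend_prod (Γ : GammaMatrices 9) :
    (List.ofFn fun a : Fin 11 => Γ.extend a).prod = 1 := by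
  rw [List.ofFn_succ_last]
  simp only [List.prod_append, extend, Fin.snoc_castSucc, Fin.snoc_last, List.prod_singleton]
  exact Γ.chirality_sq

end GammaMatrices

/-! ### Tensor fields on manifolds -/

section Manifold

variable {E : Type*} [NormedAddCommGroup E] [NormedSpace ℝ E] {H : Type*} [TopologicalSpace H]
  (I : ModelWithCorners ℝ E H) (M : Type*) [TopologicalSpace M] [ChartedSpace H M]

/-- Differential `k`-forms (not necessarily smooth). -/
abbrev DiffForm (k : ℕ) : Type _ := ∀ x : M, TangentSpace I x [⋀^Fin k]→L[ℝ] ℝ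

/-- Fields of bilinear forms on the tangent bundle. -/
abbrev BilinField : Type _ := ∀ x : M, TangentSpace I x →L[ℝ] TangentSpace I x →L[ℝ] ℝ

variable {I M}

/-- `g` is a smooth Lorentz metric of signature `(-,+,…,+)` on the `(n+1)`-manifold `M`. -/
structure IsLorentzMetric [IsManifold I ∞ M] (n : ℕ) (g : BilinField I M) : Prop where
  smooth : ContMDiff I (I.prod 𝓘(ℝ, E →L[ℝ] E →L[ℝ] ℝ)) ∞
    (fun x => (⟨x, g x⟩ : Bundle.TotalSpace (E →L[ℝ] E →L[ℝ] ℝ)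
      (fun x : M => TangentSpace I x →L[ℝ] TangentSpace I x →L[ℝ] ℝ)))
  symm : ∀ x X Y, g x X Y = g x Y X
  signature : ∀ x, ∃ b : Module.Basis (Fin (n + 1)) ℝ (TangentSpace I x),
    ∀ i j, g x (b i) (b j) = if i = j then eta i else 0

/-- The expression of a form in the preferred chart at `x₀`. -/
def inChart {k : ℕ} (F : DiffForm I M k) (x₀ : M) (y : E) : E [⋀^Fin k]→L[ℝ] ℝ :=
  (F ((extChartAt I x₀).symm y)).compContinuousLinearMap
    (mfderivWithin 𝓘(ℝ, E) I (extChartAt I x₀).symm (Set.range I) y)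

/-- Smoothness of a differential form. -/
def SmoothForm {k : ℕ} (F : DiffForm I M k) : Prop :=
  ∀ x₀ : M, ContDiffOn ℝ ∞ (inChart F x₀) (extChartAt I x₀).target

/-- The exterior derivative of a differential form, computed in charts. -/
def extD {k : ℕ} (F : DiffForm I M k) : DiffForm I M (k + 1) := fun x =>
  (extDerivWithin (inChart F x) (Set.range I) (extChartAt I x x)).compContinuousLinearMap
    (mfderiv I 𝓘(ℝ, E) (extChartAt I x) x)

/-- A `1`-form as a field of covectors. -/
def covec (F : DiffForm I M 1) (x : M) : TangentSpace I x →L[ℝ] ℝ :=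
  (ContinuousAlternatingMap.ofSubsingleton ℝ (TangentSpace I x) ℝ (0 : Fin 1)).symm (F x)

/-- The differential of a function as a `1`-form. -/
def dFun (I : ModelWithCorners ℝ E H) (f : M → ℝ) : DiffForm I M 1 := fun x =>
  ContinuousAlternatingMap.ofSubsingleton ℝ (TangentSpace I x) ℝ (0 : Fin 1) (mvfderiv I f x)

/-- The wedge product `α ∧ β` of a covector with a `k`-form,
`(α ∧ β)(v₀,…,v_k) = ∑ᵢ (-1)ⁱ α(vᵢ) β(v₀,…,v̂ᵢ,…,v_k)`. -/
def covecWedge {V : Type*} [NormedAddCommGroup V] [NormedSpace ℝ V] {k : ℕ}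
    (α : V →L[ℝ] ℝ) (β : V [⋀^Fin k]→L[ℝ] ℝ) : V [⋀^Fin (k + 1)]→L[ℝ] ℝ :=
  .alternatizeUncurryFin (α.smulRight β)

/-- The wedge product `α ∧ β` of a `1`-form `α` with a `k`-form `β`. -/
def wedgeLeft {k : ℕ} (α : DiffForm I M 1) (β : DiffForm I M k) : DiffForm I M (k + 1) :=
  fun x => covecWedge (V := E) (covec α x) (β x)

/-- The wedge product `β ∧ α = (-1)ᵏ α ∧ β` of a `k`-form `β` with a `1`-form `α`. -/
def wedgeRight {k : ℕ} (β : DiffForm I M k) (α : DiffForm I M 1) : DiffForm I M (k + 1) :=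
  fun x => (-1 : ℝ) ^ k • wedgeLeft α β x

/-- Pull-back of differential forms. -/
def pull {E' : Type*} [NormedAddCommGroup E'] [NormedSpace ℝ E'] {H' : Type*}
    [TopologicalSpace H'] {I' : ModelWithCorners ℝ E' H'} {M' : Type*} [TopologicalSpace M']
    [ChartedSpace H' M'] {k : ℕ} (f : M' → M) (F : DiffForm I M k) : DiffForm I' M' k :=
  fun x => (F (f x)).compContinuousLinearMap (mfderiv I' I f x)

/-- The Levi-Civita connection through the Koszul formula: `koszul g X Y Z = g(∇_X Y, Z)`. -/
def koszul (g : BilinField I M) (X Y Z : ∀ x : M, TangentSpace I x) (x : M) : ℝ :=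
  (1 / 2) * (mvfderiv I (fun y => g y (Y y) (Z y)) x (X x)
    + mvfderiv I (fun y => g y (X y) (Z y)) x (Y x)
    - mvfderiv I (fun y => g y (X y) (Y y)) x (Z x)
    + g x (VectorField.mlieBracket I X Y x) (Z x)
    - g x (VectorField.mlieBracket I X Z x) (Y x)
    - g x (VectorField.mlieBracket I Y Z x) (X x))

variable {n : ℕ}

/-- The connection `1`-forms of the Levi-Civita connection in an orthonormal frame `e`:
`ω_{ab}(X) = g(∇_X e_a, e_b) = ∑_c X^c g(∇_{e_c} e_a, e_b)` for `X = ∑_c X^c e_c`. -/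
def connForm (g : BilinField I M) (e : Fin (n + 1) → ∀ x : M, TangentSpace I x)
    (a b : Fin (n + 1)) (x : M) (X : TangentSpace I x) : ℝ :=
  ∑ c, (eta c * g x X (e c x)) * koszul g (e c) (e a) (e b) x

/-! ### Spinors -/

/-- The covariant derivative of a spinor given in the local orthonormal frame `e` by `ψ`:
`∇_X ψ = dψ(X) - (1/4) ω_{ab}(X) Γ^{ab} ψ`. -/
def spinDeriv (Γ : GammaMatrices n) (g : BilinField I M)
    (e : Fin (n + 1) → ∀ x : M, TangentSpace I x) (ψ : M → Spinor) (x : M)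
    (X : TangentSpace I x) : Spinor :=
  mvfderiv I ψ x X - (1 / 4 : ℝ) • ∑ a, ∑ b, connForm g e a b x X • (Γ.up ![a, b] *ᵥ ψ x)

/-- Clifford multiplication by the tangent vector `X = ∑ X^a e_a`, in the frame `e`. -/
def vecMul (Γ : GammaMatrices n) (g : BilinField I M)
    (e : Fin (n + 1) → ∀ x : M, TangentSpace I x) (x : M) (X : TangentSpace I x) : Mat :=
  ∑ a, (eta a * g x X (e a x)) • Γ a

/-- Clifford multiplication by the differential form `F`, in the frame `e`. -/
def formMul (Γ : GammaMatrices n) (e : Fin (n + 1) → ∀ x : M, TangentSpace I x) {k : ℕ}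
    (F : DiffForm I M k) (x : M) : Mat :=
  Γ.form (fun a => e a x) (F x).toAlternatingMap

/-- Clifford multiplication by the contraction `i_X F`, in the frame `e`. -/
def contrMul (Γ : GammaMatrices n) (e : Fin (n + 1) → ∀ x : M, TangentSpace I x) {k : ℕ}
    (F : DiffForm I M (k + 1)) (x : M) (X : TangentSpace I x) : Mat :=
  Γ.form (fun a => e a x) ((F x).toAlternatingMap.curryLeft X)

/-- Local frames `e_i` on sets `U_i` together with matrix valued transition functions. -/
structure SpinFrames (n : ℕ) (I : ModelWithCorners ℝ E H) (M : Type*) [TopologicalSpace M]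
    [ChartedSpace H M] (ι : Type*) where
  dom : ι → Set M
  frame : ι → Fin (n + 1) → ∀ x : M, TangentSpace I x
  trans : ι → ι → M → Mat

/-- A spin structure on `(M, g)`, given by local trivialisations: smooth local orthonormal frames
`e_i = λ(s_i)` covering `M` and smooth transition functions `h_{ij}` with values in the
orthochronous spin group, `s_j = s_i h_{ij}`, which form a cocycle and cover the changes of
frame, that is `h_{ij} Γ(v) h_{ij}⁻¹ = Γ(Λ_{ij} v)` for `e_{j,a} = ∑_b (Λ_{ij})^b_a e_{i,b}`. -/
structure IsSpinStructure [IsManifold I ∞ M] {ι : Type*} (Γ : GammaMatrices n) (g : BilinField I M)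
    (S : SpinFrames n I M ι) : Prop where
  isOpen : ∀ i, IsOpen (S.dom i)
  cover : ⋃ i, S.dom i = Set.univ
  smooth_frame : ∀ i a, ContMDiffOn I I.tangent ∞
    (fun x => (⟨x, S.frame i a x⟩ : TangentBundle I M)) (S.dom i)
  orthonormal : ∀ i, ∀ x ∈ S.dom i, ∀ a b,
    g x (S.frame i a x) (S.frame i b x) = if a = b then eta a else 0
  mem_spin : ∀ i j, ∀ x ∈ S.dom i ∩ S.dom j, S.trans i j x ∈ Γ.spin
  smooth_trans : ∀ i j r s, ContMDiffOn I 𝓘(ℝ, ℂ) ∞ (fun x => S.trans i j x r s)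
    (S.dom i ∩ S.dom j)
  cocycle : ∀ i j k, ∀ x ∈ S.dom i ∩ S.dom j ∩ S.dom k,
    S.trans i j x * S.trans j k x = S.trans i k x
  covers : ∀ i j, ∀ x ∈ S.dom i ∩ S.dom j, ∀ a,
    S.trans i j x * Γ a =
      (∑ b, (eta b * g x (S.frame j a x) (S.frame i b x)) • Γ b) * S.trans i j x

/-- A smooth section of the spinor bundle, `Ψ = [s_i, ψ_i]` on `U_i`. -/
structure IsSpinorField {ι : Type*} (S : SpinFrames n I M ι) (ψ : ι → M → Spinor) : Prop where
  smooth : ∀ i, ContMDiffOn I 𝓘(ℝ, Spinor) ∞ (ψ i) (S.dom i)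
  compat : ∀ i j, ∀ x ∈ S.dom i ∩ S.dom j, ψ i x = S.trans i j x *ᵥ ψ j x

/-- The spinor field does not vanish identically. -/
def IsNonzero {ι : Type*} (S : SpinFrames n I M ι) (ψ : ι → M → Spinor) : Prop :=
  ∃ i, ∃ x ∈ S.dom i, ψ i x ≠ 0

/-- `σ` is a real structure on the space of Dirac spinors: antilinear, equivariant under the spin
group, with `σ² = Id`. -/
def IsRealStructure (Γ : GammaMatrices n) (σ : Spinor →ₛₗ[starRingEnd ℂ] Spinor) : Prop :=
  (∀ v, σ (σ v) = v) ∧ ∀ A ∈ Γ.spin, ∀ v, σ (A *ᵥ v) = A *ᵥ σ v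

/-- The spinor field is a Majorana spinor for the real structure `σ`. -/
def IsMajorana {ι : Type*} (S : SpinFrames n I M ι) (σ : Spinor →ₛₗ[starRingEnd ℂ] Spinor)
    (ψ : ι → M → Spinor) : Prop :=
  ∀ i, ∀ x ∈ S.dom i, σ (ψ i x) = ψ i x

/-- The left hand side of the gravitino Killing spinor equation of eleven-dimensional supergravity,
`∇_X ψ + (1/24) (3 G · (X · ψ) - X · (G · ψ))`, in the local orthonormal frame `e`. -/
def gravitino11 (Γ : GammaMatrices 10) (g : BilinField I M)
    (e : Fin 11 → ∀ x : M, TangentSpace I x) (G : DiffForm I M 4) (ψ : M → Spinor) (x : M)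
    (X : TangentSpace I x) : Spinor :=
  spinDeriv Γ g e ψ x X + (1 / 24 : ℝ) •
    ((3 : ℝ) • (formMul Γ e G x *ᵥ (vecMul Γ g e x X *ᵥ ψ x))
      - vecMul Γ g e x X *ᵥ (formMul Γ e G x *ᵥ ψ x))

/-- The left hand side of the dilatino Killing spinor equation of type IIA supergravity,
`((1/4) e^φ G₂ - (1/3) dφ Γ₁₁ + (1/12) e^φ G̃₄ Γ₁₁ + (1/6) H₃) · ψ`. -/
def dilatino (Γ : GammaMatrices 9) (e : Fin 10 → ∀ x : M, TangentSpace I x) (φ : M → ℝ)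
    (G₂ : DiffForm I M 2) (H₃ : DiffForm I M 3) (G₄ : DiffForm I M 4) (ψ : M → Spinor) (x : M) :
    Spinor :=
  ((1 / 4 * Real.exp (φ x)) • formMul Γ e G₂ x
    - (1 / 3 : ℝ) • (formMul Γ e (dFun I φ) x * Γ.chirality)
    + (1 / 12 * Real.exp (φ x)) • (formMul Γ e G₄ x * Γ.chirality)
    + (1 / 6 : ℝ) • formMul Γ e H₃ x) *ᵥ ψ x

/-- The left hand side of the gravitino Killing spinor equation of type IIA supergravity,
`∇_X ψ - (1/4) (i_X H₃) · Γ₁₁ ψ + (1/8) e^φ (G̃₄ · (X · ψ) + G₂ · (X · Γ₁₁ ψ))`. -/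
def gravitino (Γ : GammaMatrices 9) (g : BilinField I M)
    (e : Fin 10 → ∀ x : M, TangentSpace I x) (φ : M → ℝ)
    (G₂ : DiffForm I M 2) (H₃ : DiffForm I M 3) (G₄ : DiffForm I M 4) (ψ : M → Spinor) (x : M)
    (X : TangentSpace I x) : Spinor :=
  spinDeriv Γ g e ψ x X - (1 / 4 : ℝ) • (contrMul Γ e H₃ x X *ᵥ (Γ.chirality *ᵥ ψ x))
    + (1 / 8 * Real.exp (φ x)) •
      (formMul Γ e G₄ x *ᵥ (vecMul Γ g e x X *ᵥ ψ x)
        + formMul Γ e G₂ x *ᵥ (vecMul Γ g e x X *ᵥ (Γ.chirality *ᵥ ψ x)))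

end Manifold

/-! ### The circle -/

/-- `α` is the volume form of a rotation invariant metric on the circle (the metric is then
`α ⊗ α`): a smooth, nowhere vanishing, rotation invariant `1`-form. -/
structure IsInvariantVolumeForm (α : DiffForm (𝓡 1) Circle 1) : Prop where
  smooth : SmoothForm α
  ne_zero : ∀ z, α z ≠ 0
  invariant : ∀ w : Circle, pull (I' := 𝓡 1) (fun z : Circle => w * z) α = α

/-- The vector field `S` along the circle with `α(S) = 1`. -/
def circleVector (α : DiffForm (𝓡 1) Circle 1) (z : Circle) : TangentSpace (𝓡 1) z :=
  (covec α z (EuclideanSpace.single 0 1 : EuclideanSpace ℝ (Fin 1)))⁻¹ •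
    (EuclideanSpace.single 0 1 : EuclideanSpace ℝ (Fin 1))

/-! ### The dimensional reduction ansatz on `M = N × S¹` -/

section Reduction

/-- The model with corners of `N × S¹`. -/
abbrev IM : ModelWithCorners ℝ (EuclideanSpace ℝ (Fin 10) × EuclideanSpace ℝ (Fin 1))
    (ModelProd (EuclideanSpace ℝ (Fin 10)) (EuclideanSpace ℝ (Fin 1))) := (𝓡 10).prod (𝓡 1)

variable {N : Type*} [TopologicalSpace N] [ChartedSpace (EuclideanSpace ℝ (Fin 10)) N]

/-- The tangent vector `X̄ + S̄` on `N × S¹`. -/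
def pairVec (p : N × Circle) (X : TangentSpace (𝓡 10) p.1) (S : TangentSpace (𝓡 1) p.2) :
    TangentSpace IM p := (X, S)

/-- The metric `g_M` on `M = N × S¹`:
`g_M(V,W) = e^{-2φ/3} g(V_N,W_N) + e^{4φ/3} (α(V_{S¹}) - C₁(V_N)) (α(W_{S¹}) - C₁(W_N))`. -/
def metricM (g : BilinField (𝓡 10) N) (φ : N → ℝ) (C₁ : DiffForm (𝓡 10) N 1)
    (α : DiffForm (𝓡 1) Circle 1) : BilinField IM (N × Circle) := fun p =>
  let pr : TangentSpace IM p →L[ℝ] TangentSpace (𝓡 10) p.1 := mfderiv IM (𝓡 10) Prod.fst p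
  let θ : TangentSpace IM p →L[ℝ] ℝ := (covec α p.2).comp (mfderiv IM (𝓡 1) Prod.snd p)
    - (covec C₁ p.1).comp pr
  Real.exp (-2 * φ p.1 / 3) • ((ContinuousLinearMap.precomp ℝ pr).comp ((g p.1).comp pr))
    + Real.exp (4 * φ p.1 / 3) • θ.smulRight θ

theorem metricM_apply (g : BilinField (𝓡 10) N) (φ : N → ℝ) (C₁ : DiffForm (𝓡 10) N 1)
    (α : DiffForm (𝓡 1) Circle 1) (p : N × Circle) (X Y : TangentSpace (𝓡 10) p.1)
    (S T : TangentSpace (𝓡 1) p.2) :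
    metricM g φ C₁ α p (pairVec p X S) (pairVec p Y T) =
      Real.exp (-2 * φ p.1 / 3) * g p.1 X Y + Real.exp (4 * φ p.1 / 3) *
        ((covec α p.2 S - covec C₁ p.1 X) * (covec α p.2 T - covec C₁ p.1 Y)) := by
  simp only [metricM, mfderiv_fst, mfderiv_snd]
  rfl

/-- The `3`-form `C = π_N^* C₃ + π_N^* B₂ ∧ α` on `M = N × S¹`. -/
def threeFormM (B₂ : DiffForm (𝓡 10) N 2) (C₃ : DiffForm (𝓡 10) N 3)
    (α : DiffForm (𝓡 1) Circle 1) : DiffForm IM (N × Circle) 3 := fun p =>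
  pull (I' := IM) Prod.fst C₃ p
    + wedgeRight (pull (I' := IM) Prod.fst B₂) (pull (I' := IM) Prod.snd α) p

/-- The field strength `G̃₄ = dC₃ - C₁ ∧ dB₂`. -/
def fieldStrength4 (C₁ : DiffForm (𝓡 10) N 1) (B₂ : DiffForm (𝓡 10) N 2)
    (C₃ : DiffForm (𝓡 10) N 3) : DiffForm (𝓡 10) N 4 := fun x =>
  extD C₃ x - wedgeLeft C₁ (extD B₂) x

/-- The orthonormal frame `e'_a = e^{φ/3} (ē_a + C₁(e_a) S̄)`, `e'₁₀ = e^{-2φ/3} S̄` of `g_M`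
determined by an orthonormal frame `e_a` of `g`. -/
def frameM (φ : N → ℝ) (C₁ : DiffForm (𝓡 10) N 1) (α : DiffForm (𝓡 1) Circle 1)
    (e : Fin 10 → ∀ x : N, TangentSpace (𝓡 10) x) :
    Fin 11 → ∀ p : N × Circle, TangentSpace IM p :=
  Fin.snoc (α := fun _ => ∀ p : N × Circle, TangentSpace IM p)
    (fun a p => Real.exp (φ p.1 / 3) •
      pairVec p (e a p.1) (covec C₁ p.1 (e a p.1) • circleVector α p.2))
    (fun p => Real.exp (-2 * φ p.1 / 3) • pairVec p 0 (circleVector α p.2))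

theorem covec_circleVector {α : DiffForm (𝓡 1) Circle 1} (hα : IsInvariantVolumeForm α)
    (z : Circle) : covec α z (circleVector α z) = 1 := by
  set b : EuclideanSpace ℝ (Fin 1) := EuclideanSpace.single 0 1 with hb
  have h : covec α z b ≠ 0 := by
    intro h0
    apply hα.ne_zero z
    have hc : covec α z = 0 := by
      ext v
      have hv : v = (show EuclideanSpace ℝ (Fin 1) from v) 0 • b := by
        refine (WithLp.ofLp_injective 2 ?_ : (show EuclideanSpace ℝ (Fin 1) from v) = _)
        ext i
        fin_cases i
        simp [hb]
      rw [hv]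
      erw [map_smul, h0]
      exact smul_zero _
    exact (ContinuousAlternatingMap.ofSubsingleton ℝ (TangentSpace (𝓡 1) z) ℝ
      (0 : Fin 1)).symm.injective (hc.trans rfl)
  have : covec α z (circleVector α z) = (covec α z b)⁻¹ * covec α z b := by
    unfold circleVector
    erw [map_smul]
    rfl
  rw [this, inv_mul_cancel₀ h]

/-- The frame `e'` is orthonormal for `g_M`. -/
theorem frameM_orthonormal {g : BilinField (𝓡 10) N} {α : DiffForm (𝓡 1) Circle 1}
    (hα : IsInvariantVolumeForm α) (φ : N → ℝ) (C₁ : DiffForm (𝓡 10) N 1)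
    (e : Fin 10 → ∀ x : N, TangentSpace (𝓡 10) x) (p : N × Circle)
    (he : ∀ a b, g p.1 (e a p.1) (e b p.1) = if a = b then eta (n := 9) a else 0) (a b : Fin 11) :
    metricM g φ C₁ α p (frameM φ C₁ α e a p) (frameM φ C₁ α e b p) =
      if a = b then eta (n := 10) a else 0 := by
  have h1 : Real.exp (φ p.1 / 3) * Real.exp (φ p.1 / 3) * Real.exp (-2 * φ p.1 / 3) = 1 := by
    rw [← Real.exp_add, ← Real.exp_add]; ring_nf; simp
  have h2 : Real.exp (-2 * φ p.1 / 3) * Real.exp (-2 * φ p.1 / 3) *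
      Real.exp (4 * φ p.1 / 3) = 1 := by
    rw [← Real.exp_add, ← Real.exp_add]; ring_nf; simp
  have hS := covec_circleVector hα p.2
  induction a using Fin.lastCases with
  | last =>
    induction b using Fin.lastCases with
    | last =>
      have hl : eta (Fin.last 10) = 1 := if_neg (Fin.last_pos).ne'
      simp only [frameM, Fin.snoc_last, map_smul, smul_apply, metricM_apply, hS,
        map_zero, smul_eq_mul, if_true, hl, sub_zero, mul_zero, mul_one, zero_add]
      linarith [h2]
    | cast b =>
      have hne : Fin.last 10 ≠ Fin.castSucc b := (Fin.castSucc_lt_last b).ne'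
      simp only [frameM, Fin.snoc_last, Fin.snoc_castSucc, map_smul,
        smul_apply, metricM_apply, hS, map_zero, smul_eq_mul, if_neg hne,
        zero_apply, mul_one, sub_self, mul_zero, add_zero]
  | cast a =>
    induction b using Fin.lastCases with
    | last =>
      have hne : Fin.castSucc a ≠ Fin.last 10 := (Fin.castSucc_lt_last a).ne
      simp only [frameM, Fin.snoc_last, Fin.snoc_castSucc, map_smul,
        smul_apply, metricM_apply, hS, map_zero, smul_eq_mul, if_neg hne,
        mul_one, sub_self, mul_zero, zero_mul, add_zero]
    | cast b =>
      have hc : eta (n := 10) (Fin.castSucc a) = eta (n := 9) a := by simp [eta]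
      simp only [frameM, Fin.snoc_castSucc, map_smul, smul_apply,
        metricM_apply, hS, smul_eq_mul, Fin.castSucc_inj, hc, he, mul_one, sub_self, mul_zero,
        add_zero]
      split_ifs
      · linear_combination eta (n := 9) a * h1
      · ring

/-- The spinor field `δ` on `N`, pulled back to `M = N × S¹` (so that it is described by
`δ_i ∘ π_N` with respect to the frame `e'` on `U_i × S¹`), satisfies the gravitino Killing spinor
equation of eleven-dimensional supergravity for the metric `g_M` and the field strength `G = dC`. -/
def SolvesKilling11 {ι : Type*} (Γ : GammaMatrices 9) (S : SpinFrames 9 (𝓡 10) N ι)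
    (g : BilinField (𝓡 10) N) (φ : N → ℝ) (C₁ : DiffForm (𝓡 10) N 1) (B₂ : DiffForm (𝓡 10) N 2)
    (C₃ : DiffForm (𝓡 10) N 3) (α : DiffForm (𝓡 1) Circle 1) (δ : ι → N → Spinor) : Prop :=
  ∀ i, ∀ x ∈ S.dom i, ∀ (z : Circle) (X : TangentSpace IM (x, z)),
    gravitino11 Γ.extend (metricM g φ C₁ α) (frameM φ C₁ α (S.frame i))
      (extD (threeFormM B₂ C₃ α)) (fun p => δ i p.1) (x, z) X = 0

/-- The spinor field `ε` on `N` satisfies the dilatino Killing spinor equation of type IIA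
supergravity. -/
def SolvesDilatino {ι : Type*} (Γ : GammaMatrices 9) (S : SpinFrames 9 (𝓡 10) N ι)
    (φ : N → ℝ) (C₁ : DiffForm (𝓡 10) N 1) (B₂ : DiffForm (𝓡 10) N 2)
    (C₃ : DiffForm (𝓡 10) N 3) (ε : ι → N → Spinor) : Prop :=
  ∀ i, ∀ x ∈ S.dom i,
    dilatino Γ (S.frame i) φ (extD C₁) (extD B₂) (fieldStrength4 C₁ B₂ C₃) (ε i) x = 0

/-- The spinor field `ε` on `N` satisfies the gravitino Killing spinor equation of type IIA
supergravity. -/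
def SolvesGravitino {ι : Type*} (Γ : GammaMatrices 9) (S : SpinFrames 9 (𝓡 10) N ι)
    (g : BilinField (𝓡 10) N) (φ : N → ℝ) (C₁ : DiffForm (𝓡 10) N 1) (B₂ : DiffForm (𝓡 10) N 2)
    (C₃ : DiffForm (𝓡 10) N 3) (ε : ι → N → Spinor) : Prop :=
  ∀ i, ∀ x ∈ S.dom i, ∀ X : TangentSpace (𝓡 10) x,
    gravitino Γ g (S.frame i) φ (extD C₁) (extD B₂) (fieldStrength4 C₁ B₂ C₃) (ε i) x X = 0

end Reduction

end IIA

end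

open IIA

/-! In the frame e' both sides of the problem become pure Clifford algebra over a point of N, and
the theorem is the comparison of two matrices.

The Levi-Civita connection of an orthonormal frame is determined by the brackets of the frame
(`koszul_eq_structCoeff`). The brackets of e' are those of e, corrected by derivatives of φ coming
from the exponential factors and by dC₁, which Cartan's formula produces as the vertical part of the
bracket of two horizontal lifts. Contracted with gamma matrices, with Γ'₁₀ = Γ₁₁, the spin
connection of M becomes e^{φ/3}(-e^φ G₂ + (4/3) dφ Γ₁₁) along the fibre (`sum_koszul_vertical`) and
e^{φ/3} times (the spin connection of N + (1/3)[Γ_c, dφ] + e^φ (i_c G₂) Γ₁₁) along e'_c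
(`sum_koszul_horizontal`). Since α is closed, dC = dC₃ - α ∧ H₃, and on the frame e' this gives G =
e^{φ/3}(e^φ G̃₄ - Γ₁₁ H₃) as a Clifford operator (`formMul_extD_threeFormM`).

Substitution gives two exact identities. After multiplication by e^{φ/6}, the left side of (∗) on
e'₁₀ is e^{φ/3} times the dilatino expression (`gravitino11_vertical`), and on e'_c it is e^{φ/3}
times the gravitino expression minus (1/2) Γ_c Γ₁₁ applied to the dilatino expression
(`gravitino11_horizontal`). The algebra is in `dilatino_identity` and `gravitino_identity`; the
second leaves a scalar dφ(e_c)/6, which is exactly what differentiating the weight in ε = e^{φ/6} δ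
supplies.

Both pointwise equivalences follow, because exponentials do not vanish. Linearity in X and the fact
that orthonormal frames span upgrade them to all tangent vectors. The Majorana statement follows
because δ and ε differ by a positive real function, which respects the transition matrices, the real
structure and non-vanishing. -/

noncomputable section

namespace IIA

/-! ### Clifford multiplication by forms. -/

namespace GammaMatrices

variable {n : ℕ} (Γ : GammaMatrices n)

/-- The gamma matrix with raised index, `Γ^a`. -/
def raise (a : Fin (n + 1)) : Mat := eta a • Γ a

theorem eta_mul_self (a : Fin (n + 1)) : eta a * eta a = 1 := by
  unfold eta; split_ifs <;> norm_num

theorem eta_smul_raise (a : Fin (n + 1)) : eta a • Γ.raise a = Γ a := by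
  rw [raise, smul_smul, eta_mul_self, one_smul]

theorem mul_raise (c a : Fin (n + 1)) :
    Γ c * Γ.raise a = (if a = c then (2 : ℝ) else 0) • (1 : Mat) - Γ.raise a * Γ c := by
  have h := Γ.clifford c a
  rw [raise, mul_smul_comm, smul_mul_assoc, eq_sub_iff_add_eq, ← smul_add, h, smul_smul]
  congr 1
  by_cases hca : c = a
  · subst hca
    simp only [if_true]
    rw [mul_left_comm, eta_mul_self, mul_one]
  · simp [hca, Ne.symm hca]

section Form

variable {V : Type*} [AddCommGroup V] [Module ℝ V] {k : ℕ} (e : Fin (n + 1) → V)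

/-- Antisymmetrising the gamma matrices is redundant against an alternating F: all k! permutations
contribute the same sum, which cancels one factor 1/k!. Plain products are what the inductions on
degree below can handle. -/
theorem form_eq_sum_prod (F : V [⋀^Fin k]→ₗ[ℝ] ℝ) :
    Γ.form e F = ((k.factorial : ℝ)⁻¹) • ∑ a : Fin k → Fin (n + 1),
      F (fun j => e (a j)) • (List.ofFn fun j => Γ.raise (a j)).prod := by
  have hs (s : Equiv.Perm (Fin k)) :
      ∑ a : Fin k → Fin (n + 1), F (fun j => e (a j)) •
        ((Equiv.Perm.sign s : ℤ) • (List.ofFn fun j => Γ.raise (a (s j))).prod) =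
      ∑ a : Fin k → Fin (n + 1), F (fun j => e (a j)) •
        (List.ofFn fun j => Γ.raise (a j)).prod := by
    -- Reindexing by a ↦ a ∘ s; the sign F acquires cancels the sign of s.
    refine Fintype.sum_equiv (Equiv.arrowCongr s.symm (Equiv.refl _)) _ _ fun a => ?_
    have hF : F (fun j => e (a (s j))) = (Equiv.Perm.sign s : ℤ) • F (fun j => e (a j)) := by
      simpa [Function.comp_def, Units.smul_def] using F.map_perm (fun j => e (a j)) s
    simp only [Equiv.arrowCongr_apply, Equiv.symm_symm, Equiv.coe_refl, Function.comp_apply,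
      Function.comp_def, id_eq, hF]
    rw [smul_comm, smul_assoc]
  unfold form up
  congr 1
  simp only [Finset.smul_sum]
  rw [Finset.sum_comm]
  simp only [smul_comm _ ((k.factorial : ℝ)⁻¹), ← Finset.smul_sum]
  have : ∀ s : Equiv.Perm (Fin k), ∑ a : Fin k → Fin (n + 1), F (fun j => e (a j)) •
        ((Equiv.Perm.sign s : ℤ) • (List.ofFn fun j => eta (a (s j)) • Γ (a (s j))).prod) = _ := hs
  simp only [this, Finset.sum_const, Finset.card_univ, Fintype.card_perm, Fintype.card_fin]
  rw [← Nat.cast_smul_eq_nsmul ℝ, smul_smul, inv_mul_cancel₀, one_smul]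
  exact_mod_cast k.factorial_ne_zero

theorem form_zero_left (F : V [⋀^Fin 0]→ₗ[ℝ] ℝ) : Γ.form e F = F ![] • (1 : Mat) := by
  rw [form_eq_sum_prod, Fintype.sum_unique]
  simp only [Nat.factorial_zero, Nat.cast_one, inv_one, one_smul, List.ofFn_zero, List.prod_nil]
  congr 2
  exact Subsingleton.elim _ _

/-- Splitting off the first index of the tuple; 1/(k+1) is the ratio of the factorials. Read
backwards it is Euler's identity ∑ Γ^a (i_a F) = (deg F) F, the engine of all inductions on degree.
-/
theorem form_succ (F : V [⋀^Fin (k + 1)]→ₗ[ℝ] ℝ) :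
    Γ.form e F = ((k + 1 : ℝ)⁻¹) • ∑ a, Γ.raise a * Γ.form e (F.curryLeft (e a)) := by
  rw [form_eq_sum_prod, ← (Fin.consEquiv fun _ : Fin (k + 1) => Fin (n + 1)).sum_comp,
    Fintype.sum_prod_type]
  simp only [form_eq_sum_prod, mul_smul_comm, Finset.mul_sum, ← Finset.smul_sum]
  rw [smul_smul, Nat.factorial_succ, Nat.cast_mul, mul_inv, Nat.cast_succ]
  congr 1
  refine Finset.sum_congr rfl fun a _ => Finset.sum_congr rfl fun b _ => ?_
  simp only [Fin.consEquiv, Equiv.coe_fn_mk, List.ofFn_succ, Fin.cons_zero, Fin.cons_succ,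
    List.prod_cons, AlternatingMap.curryLeft_apply_apply]
  congr 2
  funext j
  refine Fin.cases ?_ (fun j => ?_) j <;> simp

theorem form_smul (r : ℝ) (F : V [⋀^Fin k]→ₗ[ℝ] ℝ) : Γ.form e (r • F) = r • Γ.form e F := by
  simp only [form, AlternatingMap.smul_apply, smul_assoc, ← Finset.smul_sum]
  rw [smul_comm]

theorem form_add (F F' : V [⋀^Fin k]→ₗ[ℝ] ℝ) :
    Γ.form e (F + F') = Γ.form e F + Γ.form e F' := by
  simp only [form, AlternatingMap.add_apply, add_smul, Finset.sum_add_distrib, smul_add]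

theorem form_neg (F : V [⋀^Fin k]→ₗ[ℝ] ℝ) : Γ.form e (-F) = -Γ.form e F := by
  rw [← neg_one_smul ℝ F, form_smul, neg_one_smul]

/-- Clifford multiplication sees only the components in the frame, so forms on different vector
spaces can be compared. This carries the field strength from M to N. -/
theorem form_of_eq_smul {V' : Type*} [AddCommGroup V'] [Module ℝ V'] {e' : Fin (n + 1) → V'}
    {F : V [⋀^Fin k]→ₗ[ℝ] ℝ} {F' : V' [⋀^Fin k]→ₗ[ℝ] ℝ} (r : ℝ)
    (h : ∀ a : Fin k → Fin (n + 1), F' (fun j => e' (a j)) = r * F (fun j => e (a j))) :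
    Γ.form e' F' = r • Γ.form e F := by
  simp only [form, h, mul_smul, ← Finset.smul_sum]
  rw [smul_comm]

theorem form_one (F : V [⋀^Fin 1]→ₗ[ℝ] ℝ) : Γ.form e F = ∑ a, F ![e a] • Γ.raise a := by
  rw [form_succ]
  simp [form_zero_left]

theorem curryLeft_swap (F : V [⋀^Fin (k + 2)]→ₗ[ℝ] ℝ) (x y : V) :
    (F.curryLeft x).curryLeft y = -(F.curryLeft y).curryLeft x := by
  ext v
  have h := F.map_swap (Matrix.vecCons y (Matrix.vecCons x v)) (i := 0) (j := 1) (by simp)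
  simp only [AlternatingMap.curryLeft_apply_apply, AlternatingMap.neg_apply]
  rw [← h]
  congr 1
  funext j
  refine Fin.cases ?_ (fun j => Fin.cases ?_ (fun j => ?_) j) j
  · simp
  · simp
  · have : Equiv.swap (0 : Fin (k + 2)) 1 j.succ.succ = j.succ.succ := by
      apply Equiv.swap_apply_of_ne_of_ne
      · simp
      · simp [Fin.ext_iff]
    simp [this]

/-- `Γ_c F = (-1)^k F Γ_c + 2 (i_c F)` for a `k`-form `F`. -/
theorem mul_form (c : Fin (n + 1)) (F : V [⋀^Fin (k + 1)]→ₗ[ℝ] ℝ) :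
    Γ c * Γ.form e F =
      (-1 : ℝ) ^ (k + 1) • (Γ.form e F * Γ c) + (2 : ℝ) • Γ.form e (F.curryLeft (e c)) := by
  -- Γ_c is moved past the first gamma matrix only; what remains is Γ_c against a form of lower
  -- degree, ready for the induction hypothesis.
  have key {k : ℕ} (F : V [⋀^Fin (k + 1)]→ₗ[ℝ] ℝ) : Γ c * Γ.form e F = ((k + 1 : ℝ)⁻¹) •
      ((2 : ℝ) • Γ.form e (F.curryLeft (e c)) -
        ∑ a, Γ.raise a * (Γ c * Γ.form e (F.curryLeft (e a)))) := by
    rw [form_succ, mul_smul_comm, Finset.mul_sum]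
    congr 1
    simp only [← mul_assoc, mul_raise, sub_mul, Finset.sum_sub_distrib, smul_mul_assoc, one_mul]
    simp only [ite_smul, zero_smul, Finset.sum_ite_eq', Finset.mem_univ, if_true]
  induction k with
  | zero =>
    have h0 (a) : Γ c * Γ.form e (F.curryLeft (e a)) = Γ.form e (F.curryLeft (e a)) * Γ c := by
      simp [form_zero_left]
    have h1 : ∑ a, Γ.raise a * (Γ c * Γ.form e (F.curryLeft (e a))) = Γ.form e F * Γ c := by
      simp only [h0, ← mul_assoc, ← Finset.sum_mul]
      rw [form_succ]
      simp
    rw [key, h1]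
    simp only [Nat.cast_zero, zero_add, inv_one, one_smul, pow_one]
    module
  | succ k ih =>
    -- Euler's identity is used twice, for F of degree k+2 and for i_c F of degree k+1. The minus
    -- sign comes from exchanging i_a and i_c.
    have h1 : ∑ a, Γ.raise a * (Γ c * Γ.form e (F.curryLeft (e a))) =
        ((-1 : ℝ) ^ (k + 1) * (k + 2)) • (Γ.form e F * Γ c) -
          (2 * (k + 1) : ℝ) • Γ.form e (F.curryLeft (e c)) := by
      have h2 : ∑ a, Γ.raise a * Γ.form e (F.curryLeft (e a)) = (k + 2 : ℝ) • Γ.form e F := by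
        rw [Γ.form_succ e F, smul_smul]
        push_cast
        rw [show (k + 2 : ℝ) * (k + 1 + 1 : ℝ)⁻¹ = 1 by field_simp; ring, one_smul]
      have h3 : ∑ a, Γ.raise a * Γ.form e ((F.curryLeft (e c)).curryLeft (e a)) =
          (k + 1 : ℝ) • Γ.form e (F.curryLeft (e c)) := by
        rw [Γ.form_succ e (F.curryLeft (e c)), smul_smul, mul_inv_cancel₀ (by positivity),
          one_smul]
      simp only [ih, curryLeft_swap F (e _) (e c), form_neg, mul_add, mul_smul_comm, mul_neg,
        smul_neg, Finset.sum_add_distrib, Finset.sum_neg_distrib, ← Finset.smul_sum, ← mul_assoc,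
        ← Finset.sum_mul, h2, h3]
      rw [smul_mul_assoc]
      module
    rw [key, h1]
    push_cast
    rw [show (k + 1 + 1 : ℝ) = k + 2 by ring, pow_succ _ (k + 1)]
    have : (k + 2 : ℝ) ≠ 0 := by positivity
    match_scalars <;> field_simp <;> ring

/-- Antisymmetric coefficients do the antisymmetrisation. The connection forms are of this kind, so
the spin connection can be written with plain products. -/
theorem sum_up_two (w : Fin (n + 1) → Fin (n + 1) → ℝ) (hw : ∀ a b, w a b = -w b a) :
    ∑ a, ∑ b, w a b • Γ.up ![a, b] = ∑ a, ∑ b, w a b • (Γ.raise a * Γ.raise b) := by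
  have hup (a b) : Γ.up ![a, b] =
      (2⁻¹ : ℝ) • (Γ.raise a * Γ.raise b - Γ.raise b * Γ.raise a) := by
    unfold up
    congr 1
    rw [show (Finset.univ : Finset (Equiv.Perm (Fin 2))) = {1, Equiv.swap 0 1} by decide,
      Finset.sum_pair (by decide)]
    simp [raise, List.ofFn_succ, sub_eq_add_neg]
  have hsw : ∑ a, ∑ b, w a b • (Γ.raise b * Γ.raise a) =
      -∑ a, ∑ b, w a b • (Γ.raise a * Γ.raise b) := by
    rw [Finset.sum_comm]
    simp only [← Finset.sum_neg_distrib]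
    refine Finset.sum_congr rfl fun a _ => Finset.sum_congr rfl fun b _ => ?_
    rw [hw b a, neg_smul]
  simp only [hup, smul_comm _ (2⁻¹ : ℝ), ← Finset.smul_sum, smul_sub, Finset.sum_sub_distrib, hsw]
  module

theorem form_two (F : V [⋀^Fin 2]→ₗ[ℝ] ℝ) :
    Γ.form e F = (2⁻¹ : ℝ) • ∑ a, ∑ b, F ![e a, e b] • (Γ.raise a * Γ.raise b) := by
  rw [form_succ]
  norm_num [form_one, Finset.mul_sum]

theorem form_curryLeft_two (F : V [⋀^Fin 2]→ₗ[ℝ] ℝ) (x : V) :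
    Γ.form e (F.curryLeft x) = ∑ a, F ![x, e a] • Γ.raise a := by
  simp [form_one]

end Form

/-! ### Γ₁₁ and the passage from ten to eleven dimensions. -/

section Chirality

variable (Γ : GammaMatrices 9) {V : Type*} [AddCommGroup V] [Module ℝ V] {k : ℕ}

theorem raise_mul_chirality (a : Fin 10) : Γ.raise a * Γ.chirality = -(Γ.chirality * Γ.raise a) :=
    by
  rw [raise, smul_mul_assoc, chirality_anticomm, mul_smul_comm, smul_neg]

/-- Γ₁₁ anticommutes with each of the k gamma matrices, one sign per index split off. -/
theorem chirality_mul_form (e : Fin 10 → V) (F : V [⋀^Fin k]→ₗ[ℝ] ℝ) :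
    Γ.chirality * Γ.form e F = (-1 : ℝ) ^ k • (Γ.form e F * Γ.chirality) := by
  induction k with
  | zero => simp [form_zero_left]
  | succ k ih =>
    have h (a : Fin 10) : Γ.chirality * Γ.raise a = -(Γ.raise a * Γ.chirality) := by
      rw [raise_mul_chirality, neg_neg]
    rw [form_succ, mul_smul_comm, smul_mul_assoc, smul_comm]
    congr 1
    rw [Finset.mul_sum, Finset.sum_mul, Finset.smul_sum]
    refine Finset.sum_congr rfl fun a _ => ?_
    rw [← mul_assoc, h, neg_mul, mul_assoc, ih, mul_smul_comm, ← mul_assoc, pow_succ]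
    module

theorem extend_last : Γ.extend (Fin.last 10) = Γ.chirality := by
  simp only [extend, Fin.snoc_last]

theorem raise_extend_castSucc (a : Fin 10) : Γ.extend.raise a.castSucc = Γ.raise a := by
  simp [raise, extend, eta]

theorem raise_extend_last : Γ.extend.raise (Fin.last 10) = Γ.chirality := by
  have he : eta (Fin.last 10) = 1 := if_neg (Fin.last_pos).ne'
  rw [raise, he, one_smul, extend_last]

theorem extend_castSucc (a : Fin 10) : Γ.extend a.castSucc = Γ a := by
  simp [extend]

/-- Clifford multiplication by a form in dimension eleven, split into its components along and
transversal to the last basis vector. -/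
theorem form_extend (e : Fin 11 → V) (F : V [⋀^Fin (k + 1)]→ₗ[ℝ] ℝ) :
    Γ.extend.form e F = Γ.form (fun a => e a.castSucc) F +
      Γ.chirality * Γ.form (fun a => e a.castSucc) (F.curryLeft (e (Fin.last 10))) := by
  induction k with
  | zero =>
    rw [form_succ, form_succ, Fin.sum_univ_castSucc]
    simp only [raise_extend_castSucc, raise_extend_last]
    simp [form_zero_left]
  | succ k ih =>
    set l := e (Fin.last 10)
    set e₀ : Fin 10 → V := fun a => e a.castSucc
    have h3 : ∑ a, Γ.raise a * Γ.form e₀ ((F.curryLeft l).curryLeft (e₀ a)) =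
        (k + 1 : ℝ) • Γ.form e₀ (F.curryLeft l) := by
      rw [Γ.form_succ e₀ (F.curryLeft l), smul_smul, mul_inv_cancel₀ (by positivity), one_smul]
    -- Two signs cancel: Γ₁₁ moved to the left of Γ^a, and the two contractions exchanged.
    have h4 : ∑ a : Fin 10, Γ.raise a * (Γ.chirality * Γ.form e₀ ((F.curryLeft (e₀ a)).curryLeft l))
        =
        (k + 1 : ℝ) • (Γ.chirality * Γ.form e₀ (F.curryLeft l)) := by
      rw [← mul_smul_comm, ← h3, Finset.mul_sum]
      refine Finset.sum_congr rfl fun a _ => ?_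
      rw [← mul_assoc, raise_mul_chirality, curryLeft_swap, form_neg, neg_mul_neg, mul_assoc]
    -- Contracting twice with l gives zero. This term supplies the summand 1 in the count (k+1) + 1
    -- of copies of Γ₁₁ (i_l F), matching the degree k+2.
    have h5 : Γ.extend.form e (F.curryLeft l) = Γ.form e₀ (F.curryLeft l) := by
      rw [ih]
      have : (F.curryLeft l).curryLeft (e (Fin.last 10)) = 0 := AlternatingMap.curryLeft_same F l
      rw [this, ← zero_smul ℝ (0 : V [⋀^Fin k]→ₗ[ℝ] ℝ), form_smul, zero_smul, mul_zero, add_zero]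
    rw [Γ.extend.form_succ, Γ.form_succ e₀ F, Fin.sum_univ_castSucc]
    simp only [raise_extend_castSucc, raise_extend_last]
    rw [show e (Fin.last 10) = l from rfl, h5]
    simp only [show ∀ a : Fin 10, e a.castSucc = e₀ a from fun _ => rfl, ih, mul_add,
      Finset.sum_add_distrib]
    rw [h4]
    push_cast
    have : (k + 1 + 1 : ℝ) ≠ 0 := by positivity
    match_scalars <;> field_simp

/-- The index pairs (a,10) and (10,a) contribute equally, since both the coefficient and the product
with Γ₁₁ change sign; hence the factor 2. The pair (10,10) drops out. -/
theorem sum_extend (w : Fin 11 → Fin 11 → ℝ) (hw : ∀ a b, w a b = -w b a) :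
    ∑ a, ∑ b, w a b • Γ.extend.up ![a, b] =
      ∑ a : Fin 10, ∑ b : Fin 10, w a.castSucc b.castSucc • (Γ.raise a * Γ.raise b) +
        (2 : ℝ) • ((∑ a : Fin 10, w a.castSucc (Fin.last 10) • Γ.raise a) * Γ.chirality) := by
  have h0 : w (Fin.last 10) (Fin.last 10) = 0 := by linarith [hw (Fin.last 10) (Fin.last 10)]
  have h1 : ∑ b : Fin 10, w (Fin.last 10) b.castSucc • (Γ.chirality * Γ.raise b) =
      (∑ a : Fin 10, w a.castSucc (Fin.last 10) • Γ.raise a) * Γ.chirality := by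
    rw [Finset.sum_mul]
    refine Finset.sum_congr rfl fun b _ => ?_
    rw [hw, smul_mul_assoc, raise_mul_chirality, smul_neg, neg_smul]
  rw [sum_up_two _ w hw, Fin.sum_univ_castSucc]
  simp only [Fin.sum_univ_castSucc (n := 10) (fun b => w _ b • _), raise_extend_castSucc,
    raise_extend_last, h0, zero_smul, add_zero, Finset.sum_add_distrib, h1]
  rw [two_smul, ← add_assoc]
  congr 2
  rw [Finset.sum_mul]
  simp only [smul_mul_assoc]

end Chirality

end GammaMatrices

end IIA

namespace IIA

/-! ### Vector fields, brackets and exterior derivatives in the preferred chart. -/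

section Charts

open VectorField Set Filter Topology

variable {E : Type*} [NormedAddCommGroup E] [NormedSpace ℝ E] {H : Type*} [TopologicalSpace H]
  {I : ModelWithCorners ℝ E H} {M : Type*} [TopologicalSpace M] [ChartedSpace H M]

variable (I) in
/-- The expression of a vector field in the preferred chart at `x`. -/
def fieldInChart (V : ∀ x : M, TangentSpace I x) (x : M) : E → E :=
  mpullbackWithin 𝓘(ℝ, E) I (extChartAt I x).symm V (range I)

theorem mdifferentiableAt_of_comp_extChartAt_symm {F : Type*} [NormedAddCommGroup F]
    [NormedSpace ℝ F] [IsManifold I ∞ M] {f : M → F} {x : M}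
    (hf : DifferentiableAt ℝ (f ∘ (extChartAt I x).symm) (extChartAt I x x)) :
    MDifferentiableAt I 𝓘(ℝ, F) f x := by
  have h : MDifferentiableAt I 𝓘(ℝ, F) ((f ∘ (extChartAt I x).symm) ∘ extChartAt I x) x :=
    hf.mdifferentiableAt.comp x (mdifferentiableAt_extChartAt (mem_chart_source H x))
  refine h.congr_of_eventuallyEq ?_
  filter_upwards [extChartAt_source_mem_nhds (I := I) x] with y hy
  simp only [Function.comp_apply, (extChartAt I x).left_inv hy]

theorem mvfderiv_eq_fderiv [I.Boundaryless] {F : Type*} [NormedAddCommGroup F] [NormedSpace ℝ F]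
    {f : M → F}
    {x : M} (hf : MDifferentiableAt I 𝓘(ℝ, F) f x) (v : TangentSpace I x) :
    mvfderiv I f x v = fderiv ℝ (f ∘ (extChartAt I x).symm) (extChartAt I x x) v := by
  rw [hf.mvfderiv, I.range_eq_univ, fderivWithin_univ]
  rfl

/-- The tangent space at x is the model space through the preferred chart at x, so this chart has
identity derivative at its own base point. The same reason underlies the bracket and exterior
derivative formulas below. -/
theorem fieldInChart_self [IsManifold I ∞ M] (V : ∀ x : M, TangentSpace I x) (x : M) :
    fieldInChart I V x (extChartAt I x x) = V x := by
  have : IsManifold I 1 M := .of_le (n := ∞) (by exact_mod_cast le_top)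
  have h := mfderivWithin_extChartAt_symm_inverse_apply (I := I) (V x)
  rw [fieldInChart, mpullbackWithin_apply]
  rw [extChartAt_to_inv]
  exact h

theorem mlieBracket_eq_lieBracket [I.Boundaryless] [IsManifold I ∞ M]
    (V W : ∀ x : M, TangentSpace I x) (x : M) :
    mlieBracket I V W x =
      lieBracket ℝ (fieldInChart I V x) (fieldInChart I W x) (extChartAt I x x) := by
  have : IsManifold I 1 M := .of_le (n := ∞) (by exact_mod_cast le_top)
  have h (s : Set E) (hs : s = univ) (A B : E → E) (y : E) :
      lieBracketWithin ℝ A B s y = lieBracket ℝ A B y := by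
    rw [hs, lieBracketWithin_univ]
  rw [← mlieBracketWithin_univ, mlieBracketWithin_apply, mfderiv_extChartAt_self]
  refine Eq.trans ?_ (h ((extChartAt I x).symm ⁻¹' univ ∩ range I) ?_ _ _ _)
  · exact congrFun (congrArg DFunLike.coe (ContinuousLinearMap.inverse_id (R := ℝ) (M := E))) _
  · rw [I.range_eq_univ, preimage_univ, univ_inter]

theorem differentiableAt_fieldInChart [I.Boundaryless] [IsManifold I ∞ M] [CompleteSpace E]
    {V : ∀ x : M, TangentSpace I x} {x : M}
    (hV : MDifferentiableAt I I.tangent (fun x => (⟨x, V x⟩ : TangentBundle I M)) x) :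
    DifferentiableAt ℝ (fieldInChart I V x) (extChartAt I x x) := by
  have : IsManifold I 2 M := .of_le (n := ∞) (by exact WithTop.coe_le_coe.2 le_top)
  have h := (mdifferentiableWithinAt_univ.2 hV).differentiableWithinAt_mpullbackWithin_vectorField
  have h' (s : Set E) (hs : s = univ) (A : E → E) (y : E) (hA : DifferentiableWithinAt ℝ A s y) :
      DifferentiableAt ℝ A y := by
    rw [← differentiableWithinAt_univ, ← hs]; exact hA
  exact h' _ (by rw [I.range_eq_univ, preimage_univ, univ_inter]) _ _ h

theorem extD_apply [I.Boundaryless] [IsManifold I ∞ M] {k : ℕ} (F : DiffForm I M k) (x : M)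
    (v : Fin (k + 1) → TangentSpace I x) :
    extD F x v = extDeriv (inChart F x) (extChartAt I x x) v := by
  have : IsManifold I 1 M := .of_le (n := ∞) (by exact_mod_cast le_top)
  rw [extD, mfderiv_extChartAt_self, I.range_eq_univ, extDerivWithin_univ]
  rfl

theorem inChart_self [IsManifold I ∞ M] {k : ℕ} (F : DiffForm I M k) (x : M)
    (v : Fin k → TangentSpace I x) :
    inChart F x (extChartAt I x x) v = F x v := by
  have : IsManifold I 1 M := .of_le (n := ∞) (by exact_mod_cast le_top)
  rw [inChart, mfderivWithin_range_extChartAt_symm, extChartAt_to_inv]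
  rfl

/-- The form is pulled back by the derivative of the inverse chart and the fields by its inverse, so
the two cancel throughout the chart domain. -/
theorem inChart_fieldInChart [IsManifold I ∞ M] {k : ℕ} (F : DiffForm I M k) (x : M) {y : E}
    (hy : y ∈ (extChartAt I x).target) (V : Fin k → ∀ x : M, TangentSpace I x) :
    inChart F x y (fun i => fieldInChart I (V i) x y) =
      F ((extChartAt I x).symm y) (fun i => V i ((extChartAt I x).symm y)) := by
  have : IsManifold I 1 M := .of_le (n := ∞) (by exact_mod_cast le_top)
  have h := isInvertible_mfderivWithin_extChartAt_symm (I := I) hy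
  exact congrArg (F ((extChartAt I x).symm y)) (funext fun i => h.self_apply_inverse _)

theorem SmoothForm.differentiableAt [I.Boundaryless] {k : ℕ} {F : DiffForm I M k}
    (hF : SmoothForm F) (x : M) :
    DifferentiableAt ℝ (inChart F x) (extChartAt I x x) :=
  ((hF x).contDiffAt (extChartAt_target_mem_nhds x)).differentiableAt (by simp)

theorem covec_apply (F : DiffForm I M 1) (x : M) (v : TangentSpace I x) :
    covec F x v = F x ![v] := by
  refine (ContinuousAlternatingMap.ofSubsingleton_symm_apply_apply ℝ _ _ (0 : Fin 1)
    (F x) v).trans ?_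
  congr 1
  funext i
  simp

theorem covec_comp_extChartAt_symm [I.Boundaryless] [IsManifold I ∞ M] (C : DiffForm I M 1)
    (V : ∀ x : M, TangentSpace I x) (x : M) :
    (fun y => covec C y (V y)) ∘ (extChartAt I x).symm =ᶠ[𝓝 (extChartAt I x x)]
      fun y => inChart C x y ![fieldInChart I V x y] := by
  filter_upwards [extChartAt_target_mem_nhds (I := I) x] with y hy
  have h := inChart_fieldInChart C x hy ![V]
  rw [Function.comp_apply, covec_apply]
  refine Eq.trans ?_ (h.symm.trans ?_)
  · congr 1; funext i; simp
  · congr 1; funext i; simp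

theorem differentiableAt_inChart_apply [I.Boundaryless] [IsManifold I ∞ M] [CompleteSpace E]
    {C : DiffForm I M 1} (hC : SmoothForm C)
    {x : M} {V : ∀ x : M, TangentSpace I x}
    (hV : MDifferentiableAt I I.tangent (fun x => (⟨x, V x⟩ : TangentBundle I M)) x) :
    DifferentiableAt ℝ (fun y => inChart C x y ![fieldInChart I V x y]) (extChartAt I x x) := by
  have h1 := hC.differentiableAt x
  have h2 := differentiableAt_fieldInChart hV
  refine DifferentiableAt.continuousAlternatingMap_apply h1 fun i => ?_
  simpa using h2

theorem mdifferentiableAt_covec_apply [I.Boundaryless] [IsManifold I ∞ M] [CompleteSpace E]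
    {C : DiffForm I M 1} (hC : SmoothForm C)
    {x : M} {V : ∀ x : M, TangentSpace I x}
    (hV : MDifferentiableAt I I.tangent (fun x => (⟨x, V x⟩ : TangentBundle I M)) x) :
    MDifferentiableAt I 𝓘(ℝ, ℝ) (fun y => covec C y (V y)) x :=
  mdifferentiableAt_of_comp_extChartAt_symm <|
    (differentiableAt_inChart_apply hC hV).congr_of_eventuallyEq (covec_comp_extChartAt_symm C V x)

theorem mvfderiv_covec_apply [I.Boundaryless] [IsManifold I ∞ M] [CompleteSpace E]
    {C : DiffForm I M 1} (hC : SmoothForm C)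
    {x : M} {V : ∀ x : M, TangentSpace I x}
    (hV : MDifferentiableAt I I.tangent (fun x => (⟨x, V x⟩ : TangentBundle I M)) x)
    (X : TangentSpace I x) :
    mvfderiv I (fun y => covec C y (V y)) x X =
      fderiv ℝ (fun y => inChart C x y ![fieldInChart I V x y]) (extChartAt I x x) X := by
  rw [mvfderiv_eq_fderiv (mdifferentiableAt_covec_apply hC hV),
    (covec_comp_extChartAt_symm C V x).fderiv_eq]

theorem extDeriv_one_apply {β : E → E [⋀^Fin 1]→L[ℝ] ℝ} {x : E} {v w : E → E}
    (hβ : DifferentiableAt ℝ β x) (hv : DifferentiableAt ℝ v x) (hw : DifferentiableAt ℝ w x) :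
    extDeriv β x ![v x, w x] = fderiv ℝ (fun y => β y ![w y]) x (v x)
      - fderiv ℝ (fun y => β y ![v y]) x (w x) - β x ![lieBracket ℝ v w x] := by
  have h := extDeriv_apply_vectorField (V := ![v, w]) hβ (by
      intro i
      fin_cases i
      · exact hv
      · exact hw)
  have e1 : (fun i => (![v, w] : Fin 2 → E → E) i x) = ![v x, w x] := by
    funext i
    fin_cases i <;> rfl
  have e2 (y : E) : (0 : Fin 2).removeNth (fun i => (![v, w] : Fin 2 → E → E) i y) = ![w y] := by
    funext i; fin_cases i; rfl
  have e3 (y : E) : (1 : Fin 2).removeNth (fun i => (![v, w] : Fin 2 → E → E) i y) = ![v y] := by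
    funext i; fin_cases i; rfl
  rw [← e1, h]
  have hs : ∀ f : Fin (0 + 2) → ℝ, ∑ i, f i = f 0 + f 1 := Fin.sum_univ_two
  -- For a 1-form the general formula has two derivative terms and one bracket term.
  rw [hs, Fin.sum_univ_one, Finset.sum_eq_single_of_mem (0 : Fin 1) (by simp) (by simp)]
  trans (-1 : ℤ) ^ 0 • fderiv ℝ (fun y => β y ![w y]) x (v x)
    + (-1 : ℤ) ^ 1 • fderiv ℝ (fun y => β y ![v y]) x (w x)
    - (-1 : ℤ) ^ 0 • β x ![lieBracket ℝ v w x]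
  · refine congrArg₂ _ (congrArg₂ _ ?_ ?_) ?_
    · exact congrArg (fun f => (-1 : ℤ) ^ 0 • fderiv ℝ f x (v x))
        (funext fun y => congrArg (β y) (e2 y))
    · exact congrArg (fun f => (-1 : ℤ) ^ 1 • fderiv ℝ f x (w x))
        (funext fun y => congrArg (β y) (e3 y))
    · refine congrArg (fun u => (-1 : ℤ) ^ 0 • β x u) ?_
      funext i; fin_cases i; rfl
  · simp [sub_eq_add_neg]

/-- Cartan's formula for the exterior derivative of a `1`-form. -/
theorem extD_one_apply [I.Boundaryless] [IsManifold I ∞ M] [CompleteSpace E] {C : DiffForm I M 1}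
    (hC : SmoothForm C) {x : M}
    {V W : ∀ x : M, TangentSpace I x}
    (hV : MDifferentiableAt I I.tangent (fun x => (⟨x, V x⟩ : TangentBundle I M)) x)
    (hW : MDifferentiableAt I I.tangent (fun x => (⟨x, W x⟩ : TangentBundle I M)) x) :
    extD C x ![V x, W x] = mvfderiv I (fun y => covec C y (W y)) x (V x)
      - mvfderiv I (fun y => covec C y (V y)) x (W x) - covec C x (mlieBracket I V W x) := by
  have h := extDeriv_one_apply (hC.differentiableAt x) (differentiableAt_fieldInChart hV)
    (differentiableAt_fieldInChart hW)
  rw [extD_apply, mvfderiv_covec_apply hC hW, mvfderiv_covec_apply hC hV, covec_apply,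
    mlieBracket_eq_lieBracket, ← inChart_self]
  rw [fieldInChart_self, fieldInChart_self] at h
  exact h

end Charts
end IIA

namespace IIA

/-! ### Exterior derivative of a closed covector field wedged with a form. -/

section WedgeDerivative

open ContinuousAlternatingMap

variable {E : Type*} [NormedAddCommGroup E] [NormedSpace ℝ E] {k : ℕ}

theorem exists_hasFDerivAt_smulRight {G : Type*} [NormedAddCommGroup G] [NormedSpace ℝ G]
    {a : E → E →L[ℝ] ℝ} {b : E → G} {x : E}
    (ha : DifferentiableAt ℝ a x) (hb : DifferentiableAt ℝ b x) :
    ∃ L : E →L[ℝ] E →L[ℝ] G, HasFDerivAt (fun y => (a y).smulRight (b y)) L x ∧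
      ∀ u v, L u v = a x v • fderiv ℝ b x u + fderiv ℝ a x u v • b x :=
  ⟨_, (ContinuousLinearMap.smulRightL ℝ E G).hasFDerivAt_of_bilinear
    ha.hasFDerivAt hb.hasFDerivAt, fun u v => by simp⟩

theorem differentiableAt_covecWedge {a : E → E →L[ℝ] ℝ} {b : E → E [⋀^Fin k]→L[ℝ] ℝ} {x : E}
    (ha : DifferentiableAt ℝ a x) (hb : DifferentiableAt ℝ b x) :
    DifferentiableAt ℝ (fun y => covecWedge (a y) (b y)) x := by
  obtain ⟨L, h1, -⟩ := exists_hasFDerivAt_smulRight ha hb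
  exact ((alternatizeUncurryFinCLM ℝ E ℝ (n := k)).hasFDerivAt.comp x h1).differentiableAt

/-- `d(a ∧ b) = -a ∧ db` for a closed `1`-form `a`. -/
theorem extDeriv_covecWedge {a : E → E →L[ℝ] ℝ} {b : E → E [⋀^Fin k]→L[ℝ] ℝ} {x : E}
    (ha : DifferentiableAt ℝ a x) (hb : DifferentiableAt ℝ b x)
    (hsymm : ∀ u v, fderiv ℝ a x u v = fderiv ℝ a x v u) :
    extDeriv (fun y => covecWedge (a y) (b y)) x = -covecWedge (a x) (extDeriv b x) := by
  obtain ⟨L, h1, hL⟩ := exists_hasFDerivAt_smulRight ha hb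
  have h3 : extDeriv (fun y => covecWedge (a y) (b y)) x =
      alternatizeUncurryFin (alternatizeUncurryFinCLM ℝ E ℝ ∘L L) := by
    have h2 := (alternatizeUncurryFinCLM ℝ E ℝ (n := k)).hasFDerivAt.comp x h1
    rw [extDeriv, ← h2.fderiv]
    rfl
  -- T u v = a(u) Db(v) is the term of L with its arguments exchanged. As Da is symmetric, so is L +
  -- T; alternating it gives zero, so d(a ∧ b) is minus the alternation of T, which is a ∧ db.
  set T : E →L[ℝ] E →L[ℝ] E [⋀^Fin k]→L[ℝ] ℝ := (a x).smulRight (fderiv ℝ b x)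
  have h4 : alternatizeUncurryFin (alternatizeUncurryFinCLM ℝ E ℝ ∘L (L + T)) = 0 := by
    refine alternatizeUncurryFin_alternatizeUncurryFinCLM_comp_of_symmetric fun u v => ?_
    simp only [_root_.add_apply, hL, T, ContinuousLinearMap.smulRight_apply,
      _root_.smul_apply, hsymm u v]
    abel
  have h5 : alternatizeUncurryFinCLM ℝ E ℝ ∘L T = (a x).smulRight (extDeriv b x) := by
    ext1 u
    simp [T, extDeriv]
  rw [h3, covecWedge, ← h5, eq_neg_iff_add_eq_zero, ← alternatizeUncurryFin_add,
    ← ContinuousLinearMap.comp_add, h4]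

end WedgeDerivative

section ProductChart

/-! ### Brackets on a product manifold. -/

open VectorField Set Filter Topology

variable {E : Type*} [NormedAddCommGroup E] [NormedSpace ℝ E] {H : Type*} [TopologicalSpace H]
  {I : ModelWithCorners ℝ E H} {M : Type*} [TopologicalSpace M] [ChartedSpace H M]
  {E' : Type*} [NormedAddCommGroup E'] [NormedSpace ℝ E'] {H' : Type*} [TopologicalSpace H']
  {I' : ModelWithCorners ℝ E' H'} {M' : Type*} [TopologicalSpace M'] [ChartedSpace H' M']

theorem mem_target_prod {p : M × M'} {y : E × E'}
    (hy : y ∈ (extChartAt (I.prod I') p).target) :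
    y.1 ∈ (extChartAt I p.1).target ∧ y.2 ∈ (extChartAt I' p.2).target := by
  rw [extChartAt_prod] at hy
  exact hy

/-- Charts of a product are products of charts. Each component is found by applying the chain rule
in two ways to the inverse chart followed by a projection. -/
theorem mfderivWithin_extChartAt_symm_prod [IsManifold I ∞ M] [IsManifold I' ∞ M'] (p : M × M')
    {y : E × E'} (hy : y ∈ (extChartAt (I.prod I') p).target) (v : E × E') :
    mfderivWithin 𝓘(ℝ, E × E') (I.prod I') (extChartAt (I.prod I') p).symm
        (range (I.prod I')) y v =
      ((mfderivWithin 𝓘(ℝ, E) I (extChartAt I p.1).symm (range I) y.1 v.1,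
        mfderivWithin 𝓘(ℝ, E') I' (extChartAt I' p.2).symm (range I') y.2 v.2) : E × E') := by
  have : IsManifold I 1 M := .of_le (n := ∞) (by exact_mod_cast le_top)
  have : IsManifold I' 1 M' := .of_le (n := ∞) (by exact_mod_cast le_top)
  obtain ⟨hy1, hy2⟩ := mem_target_prod hy
  have hyr : y ∈ range (I.prod I') := extChartAt_target_subset_range _ hy
  have hu : UniqueMDiffWithinAt 𝓘(ℝ, E × E') (range (I.prod I')) y :=
    ((I.prod I').uniqueMDiffOn) y hyr
  have hr (x : E × E') (hx : x ∈ range (I.prod I')) : x.1 ∈ range I ∧ x.2 ∈ range I' := by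
    rw [ModelWithCorners.range_prod] at hx
    exact hx
  have h := mdifferentiableWithinAt_extChartAt_symm (I := I.prod I') (x := p) hy
  have c1 := mfderiv_comp_mfderivWithin y
    (mdifferentiableAt_fst (I := I) (I' := I') (x := (extChartAt (I.prod I') p).symm y)) h hu
  have c2 := mfderiv_comp_mfderivWithin y
    (mdifferentiableAt_snd (I := I) (I' := I') (x := (extChartAt (I.prod I') p).symm y)) h hu
  have d1 := mfderivWithin_comp (I := 𝓘(ℝ, E × E')) (f := Prod.fst) y
    (mdifferentiableWithinAt_extChartAt_symm (I := I) (x := p.1) hy1)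
    (ContinuousLinearMap.fst ℝ E E').mdifferentiableWithinAt (fun x hx => (hr x hx).1) hu
  have d2 := mfderivWithin_comp (I := 𝓘(ℝ, E × E')) (f := Prod.snd) y
    (mdifferentiableWithinAt_extChartAt_symm (I := I') (x := p.2) hy2)
    (ContinuousLinearMap.snd ℝ E E').mdifferentiableWithinAt (fun x hx => (hr x hx).2) hu
  have f1 : mfderivWithin 𝓘(ℝ, E × E') 𝓘(ℝ, E) Prod.fst (range (I.prod I')) y =
      ContinuousLinearMap.fst ℝ E E' := (ContinuousLinearMap.fst ℝ E E').mfderivWithin_eq hu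
  have f2 : mfderivWithin 𝓘(ℝ, E × E') 𝓘(ℝ, E') Prod.snd (range (I.prod I')) y =
      ContinuousLinearMap.snd ℝ E E' := (ContinuousLinearMap.snd ℝ E E').mfderivWithin_eq hu
  have e1 : (Prod.fst : M × M' → M) ∘ (extChartAt (I.prod I') p).symm =
      (extChartAt I p.1).symm ∘ Prod.fst := by
    rw [extChartAt_prod]; rfl
  have e2 : (Prod.snd : M × M' → M') ∘ (extChartAt (I.prod I') p).symm =
      (extChartAt I' p.2).symm ∘ Prod.snd := by
    rw [extChartAt_prod]; rfl
  rw [mfderiv_fst, e1, d1, f1] at c1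
  rw [mfderiv_snd, e2, d2, f2] at c2
  exact Prod.ext (congrArg (fun L : E × E' →L[ℝ] E => L v) c1).symm
    (congrArg (fun L : E × E' →L[ℝ] E' => L v) c2).symm

/-- All vectors of the frame e' have the shape A + f S with f a function on the base, so only
brackets of such fields are needed. -/
theorem fieldInChart_prod [IsManifold I ∞ M] [IsManifold I' ∞ M'] (p : M × M')
    {y : E × E'} (hy : y ∈ (extChartAt (I.prod I') p).target)
    (V : ∀ p : M × M', TangentSpace (I.prod I') p) (A : ∀ x : M, TangentSpace I x)
    (S : ∀ x : M', TangentSpace I' x) (f : M → ℝ)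
    (hV : ∀ p, V p = ((A p.1, f p.1 • S p.2) : E × E')) :
    fieldInChart (I.prod I') V p y =
      (fieldInChart I A p.1 y.1, f ((extChartAt I p.1).symm y.1) • fieldInChart I' S p.2 y.2) := by
  have : IsManifold I 1 M := .of_le (n := ∞) (by exact_mod_cast le_top)
  have : IsManifold I' 1 M' := .of_le (n := ∞) (by exact_mod_cast le_top)
  obtain ⟨hy1, hy2⟩ := mem_target_prod hy
  have h := isInvertible_mfderivWithin_extChartAt_symm (I := I.prod I') hy
  have h1 := isInvertible_mfderivWithin_extChartAt_symm (I := I) hy1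
  have h2 := isInvertible_mfderivWithin_extChartAt_symm (I := I') hy2
  refine (h.inverse_apply_eq).2 ?_
  rw [hV]
  refine Eq.trans ?_ (mfderivWithin_extChartAt_symm_prod p hy _).symm
  have e : (extChartAt (I.prod I') p).symm y =
      ((extChartAt I p.1).symm y.1, (extChartAt I' p.2).symm y.2) := by
    rw [extChartAt_prod]; rfl
  refine Prod.ext ?_ ?_
  · rw [e]
    exact (h1.self_apply_inverse _).symm
  · rw [e]
    refine Eq.trans ?_ (map_smul _ _ _).symm
    exact congrArg _ (h2.self_apply_inverse _).symm

/-- Both vertical parts are multiples of the same s by functions constant along the fibre, so the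
terms differentiating s cancel and only the coefficients are differentiated, along the horizontal
parts. -/
theorem lieBracket_prod {v v' : E → E} {s : E' → E'} {f f' : E → ℝ} {y : E × E'}
    (hv : DifferentiableAt ℝ v y.1) (hv' : DifferentiableAt ℝ v' y.1)
    (hf : DifferentiableAt ℝ f y.1) (hf' : DifferentiableAt ℝ f' y.1)
    (hs : DifferentiableAt ℝ s y.2) :
    lieBracket ℝ (fun y : E × E' => (v y.1, f y.1 • s y.2))
        (fun y : E × E' => (v' y.1, f' y.1 • s y.2)) y =
      (lieBracket ℝ v v' y.1,
        (fderiv ℝ f' y.1 (v y.1) - fderiv ℝ f y.1 (v' y.1)) • s y.2) := by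
  have key {v : E → E} {f : E → ℝ} (hv : DifferentiableAt ℝ v y.1)
      (hf : DifferentiableAt ℝ f y.1) (u : E × E') :
      fderiv ℝ (fun y : E × E' => (v y.1, f y.1 • s y.2)) y u =
        (fderiv ℝ v y.1 u.1, f y.1 • fderiv ℝ s y.2 u.2 + fderiv ℝ f y.1 u.1 • s y.2) := by
    have a1 := hv.hasFDerivAt.comp y hasFDerivAt_fst
    have a2 := hf.hasFDerivAt.comp y hasFDerivAt_fst
    have a3 := hs.hasFDerivAt.comp y hasFDerivAt_snd
    have := (a1.prodMk (a2.smul a3)).fderiv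
    exact congrArg (fun L => L u) this
  simp only [lieBracket, key hv hf, key hv' hf']
  refine Prod.ext rfl ?_
  simp only [Prod.snd_sub, map_smul]
  module

variable [I.Boundaryless] [I'.Boundaryless] [CompleteSpace E]

theorem mlieBracket_prod [IsManifold I ∞ M] [IsManifold I' ∞ M'] (p : M × M')
    (V W : ∀ p : M × M', TangentSpace (I.prod I') p) (A B : ∀ x : M, TangentSpace I x)
    (S : ∀ x : M', TangentSpace I' x) (f h : M → ℝ)
    (hV : ∀ p, V p = ((A p.1, f p.1 • S p.2) : E × E'))
    (hW : ∀ p, W p = ((B p.1, h p.1 • S p.2) : E × E'))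
    (hA : MDifferentiableAt I I.tangent (fun x => (⟨x, A x⟩ : TangentBundle I M)) p.1)
    (hB : MDifferentiableAt I I.tangent (fun x => (⟨x, B x⟩ : TangentBundle I M)) p.1)
    (hf : MDifferentiableAt I 𝓘(ℝ, ℝ) f p.1) (hh : MDifferentiableAt I 𝓘(ℝ, ℝ) h p.1)
    (hS : DifferentiableAt ℝ (fieldInChart I' S p.2) (extChartAt I' p.2 p.2)) :
    mlieBracket (I.prod I') V W p = ((mlieBracket I A B p.1,
      (mvfderiv I h p.1 (A p.1) - mvfderiv I f p.1 (B p.1)) • S p.2) : E × E') := by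
  have h1 (V : ∀ p : M × M', TangentSpace (I.prod I') p) (A : ∀ x : M, TangentSpace I x)
      (f : M → ℝ) (hV : ∀ p, V p = ((A p.1, f p.1 • S p.2) : E × E')) :
      fieldInChart (I.prod I') V p =ᶠ[𝓝 (extChartAt (I.prod I') p p)] fun y =>
        (fieldInChart I A p.1 y.1,
          (f ∘ (extChartAt I p.1).symm) y.1 • fieldInChart I' S p.2 y.2) := by
    filter_upwards [extChartAt_target_mem_nhds (I := I.prod I') p] with y hy
    exact fieldInChart_prod p hy V A S f hV
  have hd (f : M → ℝ) (hf : MDifferentiableAt I 𝓘(ℝ, ℝ) f p.1) :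
      DifferentiableAt ℝ (f ∘ (extChartAt I p.1).symm) (extChartAt I p.1 p.1) := by
    have := hf.differentiableWithinAt_writtenInExtChartAt
    rw [I.range_eq_univ, differentiableWithinAt_univ] at this
    exact this
  have e : extChartAt (I.prod I') p p = (extChartAt I p.1 p.1, extChartAt I' p.2 p.2) := by
    rw [extChartAt_prod]; rfl
  rw [mlieBracket_eq_lieBracket, (h1 V A f hV).lieBracket_vectorField_eq (h1 W B h hW)]
  rw [e]
  have := lieBracket_prod (y := (extChartAt I p.1 p.1, extChartAt I' p.2 p.2))
    (s := fieldInChart I' S p.2)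
    (differentiableAt_fieldInChart hA) (differentiableAt_fieldInChart hB) (hd f hf) (hd h hh) hS
  refine this.trans ?_
  rw [fieldInChart_self, fieldInChart_self, fieldInChart_self, ← mlieBracket_eq_lieBracket,
    ← mvfderiv_eq_fderiv hf, ← mvfderiv_eq_fderiv hh]
  rfl

end ProductChart
end IIA

namespace IIA

/-! ### The circle direction and dC on N × S¹. -/

section ThreeForm

open Set Filter Topology

theorem covecWedge_apply {V : Type*} [NormedAddCommGroup V] [NormedSpace ℝ V] {k : ℕ}
    (a : V →L[ℝ] ℝ) (b : V [⋀^Fin k]→L[ℝ] ℝ) (v : Fin (k + 1) → V) :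
    covecWedge a b v = ∑ i : Fin (k + 1), (-1 : ℝ) ^ (i : ℕ) *
      (a (v i) * b (fun j => v (i.succAbove j))) := by
  rw [covecWedge, ContinuousAlternatingMap.alternatizeUncurryFin_apply]
  refine Finset.sum_congr rfl fun i _ => ?_
  rw [zsmul_eq_mul]
  push_cast
  rfl

/-- The basis vector of the model space of the circle. -/
def circleBasis : EuclideanSpace ℝ (Fin 1) := EuclideanSpace.single 0 1

theorem eq_smul_circleBasis (v : EuclideanSpace ℝ (Fin 1)) : v = v 0 • circleBasis := by
  ext i
  fin_cases i
  simp [circleBasis]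

/-- In one dimension α(S) = 1 determines S as the coordinate vector divided by the coefficient of α.
Differentiability of S in the chart follows from that of α. -/
theorem fieldInChart_circleVector {α : DiffForm (𝓡 1) Circle 1} (hα : IsInvariantVolumeForm α)
    (z : Circle) {w : EuclideanSpace ℝ (Fin 1)} (hw : w ∈ (extChartAt (𝓡 1) z).target) :
    fieldInChart (𝓡 1) (circleVector α) z w =
        (inChart α z w ![circleBasis])⁻¹ • circleBasis ∧ inChart α z w ![circleBasis] ≠ 0 := by
  set v := fieldInChart (𝓡 1) (circleVector α) z w with hv
  have h1 : inChart α z w ![v] = 1 := by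
    have h := inChart_fieldInChart α z hw ![circleVector α]
    rw [← covec_circleVector hα ((extChartAt (𝓡 1) z).symm w), covec_apply]
    refine Eq.trans ?_ (h.trans ?_)
    · congr 1; funext i; simp [hv]
    · congr 1; funext i; simp
  have h2 : inChart α z w ![v] = v 0 * inChart α z w ![circleBasis] := by
    have := (inChart α z w).map_update_smul ![circleBasis] 0 (v 0) circleBasis
    have e1 : Function.update ![circleBasis] 0 (v 0 • circleBasis) = ![v] := by
      funext i; fin_cases i; simp [← eq_smul_circleBasis]
    have e2 : Function.update ![circleBasis] 0 circleBasis = ![circleBasis] := by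
      funext i; fin_cases i; simp
    rw [e1, e2] at this
    exact this
  rw [h2] at h1
  refine ⟨?_, right_ne_zero_of_mul_eq_one h1⟩
  rw [← eq_inv_of_mul_eq_one_left h1]
  exact eq_smul_circleBasis v

theorem differentiableAt_fieldInChart_circleVector {α : DiffForm (𝓡 1) Circle 1}
    (hα : IsInvariantVolumeForm α) (z : Circle) :
    DifferentiableAt ℝ (fieldInChart (𝓡 1) (circleVector α) z) (extChartAt (𝓡 1) z z) := by
  have h : fieldInChart (𝓡 1) (circleVector α) z =ᶠ[𝓝 (extChartAt (𝓡 1) z z)] fun w =>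
      (inChart α z w ![circleBasis])⁻¹ • circleBasis := by
    filter_upwards [extChartAt_target_mem_nhds (I := 𝓡 1) z] with w hw
    exact (fieldInChart_circleVector hα z hw).1
  refine DifferentiableAt.congr_of_eventuallyEq ?_ h
  have h1 : DifferentiableAt ℝ (fun w => inChart α z w ![circleBasis]) (extChartAt (𝓡 1) z z) :=
    (hα.smooth.differentiableAt z).continuousAlternatingMap_apply_const _
  exact (h1.inv (fieldInChart_circleVector hα z (mem_extChartAt_target z)).2).smul_const _

variable {N : Type*} [TopologicalSpace N] [ChartedSpace (EuclideanSpace ℝ (Fin 10)) N]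

/-- The expression of a `1`-form in a chart, as a field of covectors. -/
def covecInChart (α : DiffForm (𝓡 1) Circle 1) (z : Circle) (w : EuclideanSpace ℝ (Fin 1)) :
    EuclideanSpace ℝ (Fin 1) →L[ℝ] ℝ :=
  (ContinuousAlternatingMap.ofSubsingleton ℝ _ ℝ (0 : Fin 1)).symm (inChart α z w)

theorem covecInChart_apply (α : DiffForm (𝓡 1) Circle 1) (z : Circle)
    (w v : EuclideanSpace ℝ (Fin 1)) : covecInChart α z w v = inChart α z w ![v] := by
  refine (ContinuousAlternatingMap.ofSubsingleton_symm_apply_apply ℝ _ _ (0 : Fin 1) _ v).trans ?_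
  congr 1
  funext i
  simp

theorem differentiableAt_covecInChart {α : DiffForm (𝓡 1) Circle 1} (hα : SmoothForm α)
    (z : Circle) : DifferentiableAt ℝ (covecInChart α z) (extChartAt (𝓡 1) z z) :=
  (ContinuousAlternatingMap.ofSubsingletonLIE (𝕜 := ℝ) (E := EuclideanSpace ℝ (Fin 1)) (F := ℝ)
    (0 : Fin 1)).symm.differentiable.differentiableAt.comp _ (hα.differentiableAt z)

/-- The projection of the model space of `N × S¹` to the model space of `N`. -/
abbrev modelFst : EuclideanSpace ℝ (Fin 10) × EuclideanSpace ℝ (Fin 1) →L[ℝ]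
    EuclideanSpace ℝ (Fin 10) := .fst ℝ _ _

/-- The projection of the model space of `N × S¹` to the model space of the circle. -/
abbrev modelSnd : EuclideanSpace ℝ (Fin 10) × EuclideanSpace ℝ (Fin 1) →L[ℝ]
    EuclideanSpace ℝ (Fin 1) := .snd ℝ _ _

/-- Since B₂ has even degree, B₂ ∧ α = α ∧ B₂ and no sign appears. -/
theorem threeFormM_apply (B₂ : DiffForm (𝓡 10) N 2) (C₃ : DiffForm (𝓡 10) N 3)
    (α : DiffForm (𝓡 1) Circle 1) (p : N × Circle) (X : Fin 3 → TangentSpace (𝓡 10) p.1)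
    (S : Fin 3 → TangentSpace (𝓡 1) p.2) :
    threeFormM B₂ C₃ α p (fun i => pairVec p (X i) (S i)) =
      C₃ p.1 X + ∑ i : Fin 3, (-1 : ℝ) ^ (i : ℕ) *
        (covec α p.2 (S i) * B₂ p.1 (fun j => X (i.succAbove j))) := by
  have h1 : wedgeRight (pull (I' := IM) (M' := N × Circle) Prod.fst B₂)
      (pull (I' := IM) Prod.snd α) p (fun i => pairVec p (X i) (S i)) =
      ∑ i : Fin 3, (-1 : ℝ) ^ (i : ℕ) * (covec (pull (I' := IM) (M' := N × Circle) Prod.snd α) p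
        (pairVec p (X i) (S i)) * pull (I' := IM) (M' := N × Circle) Prod.fst B₂ p
          (fun j => pairVec p (X (i.succAbove j)) (S (i.succAbove j)))) := by
    have h := covecWedge_apply
      (V := EuclideanSpace ℝ (Fin 10) × EuclideanSpace ℝ (Fin 1))
      (covec (pull (I' := IM) (M' := N × Circle) Prod.snd α) p)
      (pull (I' := IM) (M' := N × Circle) Prod.fst B₂ p) (fun i => pairVec p (X i) (S i))
    refine Eq.trans ?_ h
    have h2 : ((-1 : ℝ) ^ 2) = 1 := by norm_num
    simp only [wedgeRight, h2, one_smul]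
    rfl
  have h2 (i : Fin 3) : covec (pull (I' := IM) (M' := N × Circle) Prod.snd α) p
      (pairVec p (X i) (S i)) = covec α p.2 (S i) := by
    rw [covec_apply, covec_apply]
    simp only [pull, mfderiv_snd]
    refine congrArg (α p.2) (funext fun j => ?_)
    fin_cases j
    rfl
  have h3 {k : ℕ} (F : DiffForm (𝓡 10) N k) (X : Fin k → TangentSpace (𝓡 10) p.1)
      (S : Fin k → TangentSpace (𝓡 1) p.2) :
      pull (I' := IM) (M' := N × Circle) Prod.fst F p (fun i => pairVec p (X i) (S i)) =
        F p.1 X := by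
    simp only [pull, mfderiv_fst]
    rfl
  have h4 : threeFormM B₂ C₃ α p (fun i => pairVec p (X i) (S i)) =
      pull (I' := IM) (M' := N × Circle) Prod.fst C₃ p (fun i => pairVec p (X i) (S i)) +
      wedgeRight (pull (I' := IM) (M' := N × Circle) Prod.fst B₂)
      (pull (I' := IM) Prod.snd α) p (fun i => pairVec p (X i) (S i)) := rfl
  rw [h4, h1, h3]
  simp only [h2, h3]

/-- In a product chart both pull-backs are along linear projections of the model space, with which
the exterior derivative commutes. -/
theorem inChart_threeFormM [IsManifold (𝓡 10) ∞ N] (B₂ : DiffForm (𝓡 10) N 2)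
    (C₃ : DiffForm (𝓡 10) N 3)
    (α : DiffForm (𝓡 1) Circle 1) (p : N × Circle)
    {y : EuclideanSpace ℝ (Fin 10) × EuclideanSpace ℝ (Fin 1)}
    (hy : y ∈ (extChartAt IM p).target) :
    inChart (threeFormM B₂ C₃ α) p y =
      (inChart C₃ p.1 y.1).compContinuousLinearMap modelFst +
        covecWedge ((covecInChart α p.2 y.2).comp modelSnd)
          ((inChart B₂ p.1 y.1).compContinuousLinearMap modelFst) := by
  have e : (extChartAt IM p).symm y =
      ((extChartAt (𝓡 10) p.1).symm y.1, (extChartAt (𝓡 1) p.2).symm y.2) := by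
    rw [extChartAt_prod]; rfl
  ext v
  have h : inChart (threeFormM B₂ C₃ α) p y v =
      threeFormM B₂ C₃ α ((extChartAt IM p).symm y) (fun i => pairVec _
        (mfderivWithin 𝓘(ℝ, _) (𝓡 10) (extChartAt (𝓡 10) p.1).symm (range (𝓡 10)) y.1 (v i).1)
        (mfderivWithin 𝓘(ℝ, _) (𝓡 1) (extChartAt (𝓡 1) p.2).symm (range (𝓡 1)) y.2 (v i).2)) :=
    congrArg (threeFormM B₂ C₃ α ((extChartAt IM p).symm y))
      (funext fun i => mfderivWithin_extChartAt_symm_prod p hy (v i))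
  have h1 (i : Fin 3) : covecInChart α p.2 y.2 (v i).2 =
      covec α ((extChartAt (𝓡 1) p.2).symm y.2)
        (mfderivWithin 𝓘(ℝ, _) (𝓡 1) (extChartAt (𝓡 1) p.2).symm (range (𝓡 1)) y.2 (v i).2) := by
    rw [covecInChart_apply, covec_apply]
    refine congrArg (α _) (funext fun j => ?_)
    fin_cases j
    rfl
  rw [h, e, threeFormM_apply, ContinuousAlternatingMap.add_apply, covecWedge_apply]
  simp only [ContinuousLinearMap.comp_apply, ContinuousLinearMap.coe_snd', h1]
  rfl

/-- This is dC = dC₃ - α ∧ dB₂ written out on vectors; it rests on α being closed. -/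
theorem extD_threeFormM [IsManifold (𝓡 10) ∞ N] {B₂ : DiffForm (𝓡 10) N 2} (hB₂ : SmoothForm B₂)
    {C₃ : DiffForm (𝓡 10) N 3} (hC₃ : SmoothForm C₃)
    {α : DiffForm (𝓡 1) Circle 1} (hα : SmoothForm α) (p : N × Circle)
    (X : Fin 4 → TangentSpace (𝓡 10) p.1) (S : Fin 4 → TangentSpace (𝓡 1) p.2) :
    extD (threeFormM B₂ C₃ α) p (fun i => pairVec p (X i) (S i)) =
      extD C₃ p.1 X - ∑ i : Fin 4, (-1 : ℝ) ^ (i : ℕ) *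
        (covec α p.2 (S i) * extD B₂ p.1 (fun j => X (i.succAbove j))) := by
  set y₀ := extChartAt IM p p with hy₀
  have e : y₀ = (extChartAt (𝓡 10) p.1 p.1, extChartAt (𝓡 1) p.2 p.2) := by
    rw [hy₀, extChartAt_prod]; rfl
  have h1 : inChart (threeFormM B₂ C₃ α) p =ᶠ[𝓝 y₀] fun y =>
      (inChart C₃ p.1 y.1).compContinuousLinearMap modelFst +
        covecWedge ((covecInChart α p.2 y.2).comp modelSnd)
          ((inChart B₂ p.1 y.1).compContinuousLinearMap modelFst) := by
    filter_upwards [extChartAt_target_mem_nhds (I := IM) p] with y hy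
    exact inChart_threeFormM B₂ C₃ α p hy
  have hd {k : ℕ} {F : DiffForm (𝓡 10) N k} (hF : SmoothForm F) :
      DifferentiableAt ℝ (fun y : EuclideanSpace ℝ (Fin 10) × EuclideanSpace ℝ (Fin 1) =>
        (inChart F p.1 y.1).compContinuousLinearMap modelFst) y₀ ∧
      extDeriv (fun y : EuclideanSpace ℝ (Fin 10) × EuclideanSpace ℝ (Fin 1) =>
        (inChart F p.1 y.1).compContinuousLinearMap modelFst) y₀ =
      (extDeriv (inChart F p.1) y₀.1).compContinuousLinearMap modelFst := by
    have h0 : DifferentiableAt ℝ (inChart F p.1) y₀.1 := by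
      rw [e]; exact hF.differentiableAt p.1
    have hf : fderiv ℝ modelFst = fun _ => modelFst := funext fun _ => modelFst.fderiv
    constructor
    · exact (ContinuousAlternatingMap.compContinuousLinearMapCLM
        modelFst).differentiableAt.comp _ (h0.comp _ differentiableAt_fst)
    · have := extDeriv_pullback (f := modelFst) (x := y₀) h0
        (r := ⊤) modelFst.contDiff.contDiffAt le_top
      rw [hf] at this
      exact this
  have ha : HasFDerivAt (fun y : EuclideanSpace ℝ (Fin 10) × EuclideanSpace ℝ (Fin 1) =>
      (covecInChart α p.2 y.2).comp modelSnd)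
      (((ContinuousLinearMap.compL ℝ _ _ ℝ).flip modelSnd).comp
        ((fderiv ℝ (covecInChart α p.2) y₀.2).comp modelSnd)) y₀ := by
    have h0 : DifferentiableAt ℝ (covecInChart α p.2) y₀.2 := by
      rw [e]; exact differentiableAt_covecInChart hα p.2
    exact ((ContinuousLinearMap.compL ℝ _ _ ℝ).flip modelSnd).hasFDerivAt.comp _
      (h0.hasFDerivAt.comp _ hasFDerivAt_snd)
  have hw := extDeriv_covecWedge ha.differentiableAt (hd hB₂).1 (fun u v => by
    rw [ha.fderiv]
    simp only [ContinuousLinearMap.comp_apply, ContinuousLinearMap.flip_apply,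
      ContinuousLinearMap.compL_apply, ContinuousLinearMap.coe_snd']
    -- Closedness of α: a bilinear form on a one-dimensional space is symmetric.
    rw [eq_smul_circleBasis u.2, eq_smul_circleBasis v.2]
    simp only [map_smul, _root_.smul_apply, smul_eq_mul]
    ring)
  rw [extD_apply, h1.extDeriv_eq, extDeriv_fun_add (hd hC₃).1
    (differentiableAt_covecWedge ha.differentiableAt (hd hB₂).1), hw, (hd hC₃).2, (hd hB₂).2, e,
    extD_apply, sub_eq_add_neg]
  refine (ContinuousAlternatingMap.add_apply _ _ _).trans
    (congrArg₂ _ rfl (congrArg Neg.neg ?_))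
  refine (covecWedge_apply _ _ _).trans (Finset.sum_congr rfl fun i _ => ?_)
  have hc : covec α p.2 (S i) =
      covecInChart α p.2 (extChartAt (𝓡 1) p.2 p.2) (S i) := by
    rw [covec_apply, ← inChart_self]
    exact (covecInChart_apply _ _ _ _).symm
  rw [extD_apply, hc]
  rfl

end ThreeForm

end IIA

namespace IIA

/-! ### The Levi-Civita connection in an orthonormal frame. -/

section Frames

open VectorField Set Filter Topology

variable {E : Type*} [NormedAddCommGroup E] [NormedSpace ℝ E] {H : Type*} [TopologicalSpace H]
  {I : ModelWithCorners ℝ E H} {M : Type*} [TopologicalSpace M] [ChartedSpace H M] {n : ℕ}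

/-- The vectors `e_a` are orthonormal at `x`. -/
def OrthonormalAt (g : BilinField I M) (e : Fin (n + 1) → ∀ x : M, TangentSpace I x)
    (x : M) : Prop :=
  ∀ a b, g x (e a x) (e b x) = if a = b then eta a else 0

/-- The structure coefficients `g([e_a, e_b], e_c)` of a frame. -/
def structCoeff (g : BilinField I M) (e : Fin (n + 1) → ∀ x : M, TangentSpace I x)
    (a b c : Fin (n + 1)) (x : M) : ℝ :=
  g x (mlieBracket I (e a) (e b) x) (e c x)

theorem structCoeff_swap (g : BilinField I M) (e : Fin (n + 1) → ∀ x : M, TangentSpace I x)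
    (a b c : Fin (n + 1)) (x : M) : structCoeff g e a b c x = -structCoeff g e b a c x := by
  rw [structCoeff, mlieBracket_swap_apply, map_neg]
  rfl

/-- The metric has constant components in a frame orthonormal near x, so the derivative terms of the
Koszul formula vanish and only brackets remain. -/
theorem koszul_eq_structCoeff {g : BilinField I M}
    {e : Fin (n + 1) → ∀ x : M, TangentSpace I x} {x : M}
    (he : ∀ᶠ y in 𝓝 x, OrthonormalAt g e y) (a b c : Fin (n + 1)) :
    koszul g (e a) (e b) (e c) x = (1 / 2) *
      (structCoeff g e a b c x - structCoeff g e a c b x - structCoeff g e b c a x) := by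
  have h (a b : Fin (n + 1)) : mvfderiv I (fun y => g y (e a y) (e b y)) x = 0 := by
    have : (fun y => g y (e a y) (e b y)) =ᶠ[𝓝 x] fun _ => if a = b then eta a else 0 := by
      filter_upwards [he] with y hy
      exact hy a b
    rw [mvfderiv, this.mfderiv_eq, mfderiv_const]
    exact ContinuousLinearMap.comp_zero _
  simp only [koszul, h, structCoeff]
  simp

theorem koszul_antisymm {g : BilinField I M}
    {e : Fin (n + 1) → ∀ x : M, TangentSpace I x} {x : M}
    (he : ∀ᶠ y in 𝓝 x, OrthonormalAt g e y) (a b c : Fin (n + 1)) :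
    koszul g (e a) (e b) (e c) x = -koszul g (e a) (e c) (e b) x := by
  rw [koszul_eq_structCoeff he, koszul_eq_structCoeff he, structCoeff_swap g e c b]
  ring

theorem OrthonormalAt.sum_eta {g : BilinField I M}
    {e : Fin (n + 1) → ∀ x : M, TangentSpace I x} {x : M} (he : OrthonormalAt g e x)
    {G : Type*} [AddCommGroup G] [Module ℝ G] (f : Fin (n + 1) → G) (c : Fin (n + 1)) :
    ∑ a, (eta a * g x (e c x) (e a x)) • f a = f c := by
  simp only [he c, mul_ite, mul_zero, ite_smul, zero_smul]
  rw [Finset.sum_ite_eq, if_pos (Finset.mem_univ _), GammaMatrices.eta_mul_self, one_smul]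

theorem connForm_frame {g : BilinField I M}
    {e : Fin (n + 1) → ∀ x : M, TangentSpace I x} {x : M} (he : OrthonormalAt g e x)
    (a b c : Fin (n + 1)) :
    connForm g e a b x (e c x) = koszul g (e c) (e a) (e b) x :=
  he.sum_eta (fun c => koszul g (e c) (e a) (e b) x) c

theorem vecMul_frame (Γ : GammaMatrices n) {g : BilinField I M}
    {e : Fin (n + 1) → ∀ x : M, TangentSpace I x} {x : M} (he : OrthonormalAt g e x)
    (c : Fin (n + 1)) : vecMul Γ g e x (e c x) = Γ c :=
  he.sum_eta Γ c

theorem spinDeriv_frame (Γ : GammaMatrices n) {g : BilinField I M}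
    {e : Fin (n + 1) → ∀ x : M, TangentSpace I x} {x : M} (he : OrthonormalAt g e x)
    (ψ : M → Spinor) (c : Fin (n + 1)) :
    spinDeriv Γ g e ψ x (e c x) = mvfderiv I ψ x (e c x) -
      (1 / 4 : ℝ) • ((∑ a, ∑ b, koszul g (e c) (e a) (e b) x • Γ.up ![a, b]) *ᵥ ψ x) := by
  simp only [spinDeriv, connForm_frame he, Matrix.sum_mulVec, Matrix.smul_mulVec]

/-- An orthonormal system of `dim M` vectors spans the tangent space. -/
theorem OrthonormalAt.span_eq_top [FiniteDimensional ℝ E] (hn : Module.finrank ℝ E = n + 1)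
    {g : BilinField I M} {e : Fin (n + 1) → ∀ x : M, TangentSpace I x} {x : M}
    (he : OrthonormalAt g e x) : Submodule.span ℝ (range fun a => e a x) = ⊤ := by
  have hli : LinearIndependent ℝ (fun a => (e a x : TangentSpace I x)) := by
    rw [Fintype.linearIndependent_iff]
    intro r hr b
    have h := congrArg (fun v => g x v (e b x)) hr
    simp only [map_sum, map_smul, map_zero, _root_.sum_apply, _root_.smul_apply,
      _root_.zero_apply, he _ b, smul_eq_mul, mul_ite, mul_zero, Finset.sum_ite_eq',
      Finset.mem_univ, if_true] at h
    have : eta b ≠ 0 := by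
      intro h0
      have := GammaMatrices.eta_mul_self b
      rw [h0] at this
      norm_num at this
    exact (mul_eq_zero.1 h).resolve_right this
  refine LinearIndependent.span_eq_top_of_card_eq_finrank (K := ℝ) (V := E) hli ?_
  rw [Fintype.card_fin, hn]

theorem mvfderiv_exp_mul [I.Boundaryless] [IsManifold I ∞ M] {f : M → ℝ} {x : M}
    (hf : MDifferentiableAt I 𝓘(ℝ, ℝ) f x) (r : ℝ) :
    MDifferentiableAt I 𝓘(ℝ, ℝ) (fun y => Real.exp (r * f y)) x ∧
      ∀ v, mvfderiv I (fun y => Real.exp (r * f y)) x v =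
        r * Real.exp (r * f x) * mvfderiv I f x v := by
  have h1 : DifferentiableAt ℝ (f ∘ (extChartAt I x).symm) (extChartAt I x x) := by
    have := hf.differentiableWithinAt_writtenInExtChartAt
    rw [I.range_eq_univ, differentiableWithinAt_univ] at this
    exact this
  have h2 : HasFDerivAt ((fun y => Real.exp (r * f y)) ∘ (extChartAt I x).symm)
      ((Real.exp (r * f x)) • (r • fderiv ℝ (f ∘ (extChartAt I x).symm) (extChartAt I x x)))
      (extChartAt I x x) := by
    have := (h1.hasFDerivAt.const_mul r).exp
    rw [Function.comp_apply, extChartAt_to_inv] at this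
    exact this
  have h3 := mdifferentiableAt_of_comp_extChartAt_symm h2.differentiableAt
  refine ⟨h3, fun v => ?_⟩
  rw [mvfderiv_eq_fderiv h3, h2.fderiv, mvfderiv_eq_fderiv hf]
  rw [mul_comm r (Real.exp _), mul_assoc]
  rfl

end Frames

end IIA

namespace IIA

/-! ### Brackets and structure coefficients of the frame e'. -/

section ReductionFrame

open VectorField Set Filter Topology

variable {N : Type*} [TopologicalSpace N] [ChartedSpace (EuclideanSpace ℝ (Fin 10)) N]
  {g : BilinField (𝓡 10) N} {φ : N → ℝ} {C₁ : DiffForm (𝓡 10) N 1}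
  {α : DiffForm (𝓡 1) Circle 1} {e : Fin 10 → ∀ x : N, TangentSpace (𝓡 10) x}

theorem exp_add_exp {r s t : ℝ} (h : r + s = t) : Real.exp r * Real.exp s = Real.exp t := by
  rw [← Real.exp_add, h]

theorem orthonormalAt_frameM (hα : IsInvariantVolumeForm α) (φ : N → ℝ)
    (C₁ : DiffForm (𝓡 10) N 1) {p : N × Circle} (he : OrthonormalAt g e p.1) :
    OrthonormalAt (metricM g φ C₁ α) (frameM φ C₁ α e) p :=
  fun a b => frameM_orthonormal hα φ C₁ e p he a b

theorem frameM_castSucc (a : Fin 10) (p : N × Circle) :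
    frameM φ C₁ α e a.castSucc p = pairVec p (Real.exp (φ p.1 / 3) • e a p.1)
      ((Real.exp (φ p.1 / 3) * covec C₁ p.1 (e a p.1)) • circleVector α p.2) := by
  simp only [frameM, Fin.snoc_castSucc, mul_smul]
  rfl

theorem frameM_last (p : N × Circle) :
    frameM φ C₁ α e (Fin.last 10) p = pairVec p 0
      (Real.exp (-2 * φ p.1 / 3) • circleVector α p.2) := by
  simp only [frameM, Fin.snoc_last]
  exact Prod.ext (smul_zero (Real.exp (-2 * φ p.1 / 3))) rfl

/-- The metric `g_M` applied to a horizontal frame vector. -/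
theorem metricM_castSucc (hα : IsInvariantVolumeForm α) (p : N × Circle)
    (X : TangentSpace (𝓡 10) p.1) (t : ℝ) (a : Fin 10) :
    metricM g φ C₁ α p (pairVec p X (t • circleVector α p.2)) (frameM φ C₁ α e a.castSucc p) =
      Real.exp (-φ p.1 / 3) * g p.1 X (e a p.1) := by
  rw [frameM_castSucc, metricM_apply]
  simp only [map_smul, smul_eq_mul, covec_circleVector hα, mul_one, sub_self, mul_zero, add_zero]
  rw [← mul_assoc, exp_add_exp]
  ring

/-- The metric `g_M` applied to the vertical frame vector. -/
theorem metricM_last (hα : IsInvariantVolumeForm α) (p : N × Circle)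
    (X : TangentSpace (𝓡 10) p.1) (t : ℝ) :
    metricM g φ C₁ α p (pairVec p X (t • circleVector α p.2)) (frameM φ C₁ α e (Fin.last 10) p) =
      Real.exp (2 * φ p.1 / 3) * (t - covec C₁ p.1 X) := by
  rw [frameM_last, metricM_apply]
  simp only [map_smul, smul_eq_mul, covec_circleVector hα, mul_one, map_zero, mul_zero, zero_add,
    sub_zero]
  rw [mul_comm _ (Real.exp (-2 * _ / 3)), ← mul_assoc, exp_add_exp]
  ring

variable [IsManifold (𝓡 10) ∞ N]

/-- The hypotheses on the background fields and on the local frame at a point. -/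
structure FrameData (g : BilinField (𝓡 10) N) (φ : N → ℝ) (C₁ : DiffForm (𝓡 10) N 1)
    (α : DiffForm (𝓡 1) Circle 1) (e : Fin 10 → ∀ x : N, TangentSpace (𝓡 10) x) (x : N) :
    Prop where
  orthonormal : ∀ᶠ y in 𝓝 x, OrthonormalAt g e y
  frame : ∀ a, MDifferentiableAt (𝓡 10) (𝓡 10).tangent
    (fun x => (⟨x, e a x⟩ : TangentBundle (𝓡 10) N)) x
  scalar : MDifferentiableAt (𝓡 10) 𝓘(ℝ, ℝ) φ x
  form : SmoothForm C₁
  volume : IsInvariantVolumeForm α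

namespace FrameData

variable {x : N}

theorem orthonormalM (h : FrameData g φ C₁ α e x) (z : Circle) :
    ∀ᶠ p in 𝓝 (x, z), OrthonormalAt (metricM g φ C₁ α) (frameM φ C₁ α e) p := by
  have := (continuous_fst (X := N) (Y := Circle)).continuousAt.tendsto (x := (x, z))
    |>.eventually h.orthonormal
  filter_upwards [this] with p hp
  exact orthonormalAt_frameM h.volume φ C₁ hp

theorem exp_third (h : FrameData g φ C₁ α e x) : MDifferentiableAt (𝓡 10) 𝓘(ℝ, ℝ)
    (fun y => Real.exp (φ y / 3)) x ∧
    ∀ v, mvfderiv (𝓡 10) (fun y => Real.exp (φ y / 3)) x v =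
      1 / 3 * Real.exp (φ x / 3) * mvfderiv (𝓡 10) φ x v := by
  have := mvfderiv_exp_mul h.scalar (1 / 3)
  simpa only [one_div_mul_eq_div] using this

theorem exp_neg_two_thirds (h : FrameData g φ C₁ α e x) :
    MDifferentiableAt (𝓡 10) 𝓘(ℝ, ℝ) (fun y => Real.exp (-2 * φ y / 3)) x ∧
    ∀ v, mvfderiv (𝓡 10) (fun y => Real.exp (-2 * φ y / 3)) x v =
      -2 / 3 * Real.exp (-2 * φ x / 3) * mvfderiv (𝓡 10) φ x v := by
  have := mvfderiv_exp_mul h.scalar (-2 / 3)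
  simpa only [div_mul_eq_mul_div] using this

theorem scaledFrame (h : FrameData g φ C₁ α e x) (a : Fin 10) : MDifferentiableAt (𝓡 10)
    (𝓡 10).tangent
    (fun x => (⟨x, Real.exp (φ x / 3) • e a x⟩ : TangentBundle (𝓡 10) N)) x := by
  have : IsManifold (𝓡 10) 1 N := .of_le (n := ∞) (by exact_mod_cast le_top)
  exact MDifferentiableAt.smul_section h.exp_third.1 (h.frame a)

/-- Leibniz rule for f = e^{φ/3}, whose derivative is (1/3) f dφ; every term carries f². -/
theorem mlieBracket_scaledFrame (h : FrameData g φ C₁ α e x) (a b : Fin 10) :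
    mlieBracket (𝓡 10) (fun y => Real.exp (φ y / 3) • e a y)
      (fun y => Real.exp (φ y / 3) • e b y) x =
    Real.exp (2 * φ x / 3) • (mlieBracket (𝓡 10) (e a) (e b) x +
      (1 / 3 * mvfderiv (𝓡 10) φ x (e a x)) • e b x -
      (1 / 3 * mvfderiv (𝓡 10) φ x (e b x)) • e a x) := by
  have : IsManifold (𝓡 10) 2 N := .of_le (n := ∞) (by exact WithTop.coe_le_coe.2 le_top)
  set f : N → ℝ := fun y => Real.exp (φ y / 3)
  have h1 := mlieBracket_smul_left (V := e a) (W := f • e b) h.exp_third.1 (h.frame a)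
  have h2 := mlieBracket_smul_right (V := e a) (W := e b) h.exp_third.1 (h.frame b)
  refine h1.trans ?_
  rw [h2, ← exp_add_exp (show φ x / 3 + φ x / 3 = 2 * φ x / 3 by ring)]
  simp only [h.exp_third.2, Pi.smul_apply', map_smul, smul_eq_mul, f]
  module

/-- For horizontal lifts of A and B the vertical part is A(C₁(B)) - B(C₁(A)), which Cartan's formula
turns into C₁([A,B]) + dC₁(A,B): the lift of [A,B] plus the curvature dC₁ of the circle bundle. -/
theorem mlieBracket_frameM_castSucc (h : FrameData g φ C₁ α e x) (z : Circle) (a b : Fin 10) :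
    mlieBracket IM (frameM φ C₁ α e a.castSucc) (frameM φ C₁ α e b.castSucc) (x, z) =
      pairVec (x, z) (mlieBracket (𝓡 10) (fun y => Real.exp (φ y / 3) • e a y)
        (fun y => Real.exp (φ y / 3) • e b y) x)
      ((covec C₁ x (mlieBracket (𝓡 10) (fun y => Real.exp (φ y / 3) • e a y)
          (fun y => Real.exp (φ y / 3) • e b y) x) +
        Real.exp (2 * φ x / 3) * extD C₁ x ![e a x, e b x]) • circleVector α z) := by
  have hc (a : Fin 10) : (fun y => Real.exp (φ y / 3) * covec C₁ y (e a y)) =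
      fun y => covec C₁ y (Real.exp (φ y / 3) • e a y) := by
    funext y
    rw [map_smul, smul_eq_mul]
  have hd (a : Fin 10) : MDifferentiableAt (𝓡 10) 𝓘(ℝ, ℝ)
      (fun y => Real.exp (φ y / 3) * covec C₁ y (e a y)) x := by
    rw [hc]
    exact mdifferentiableAt_covec_apply h.form (h.scaledFrame a)
  have h1 := mlieBracket_prod (x, z) (frameM φ C₁ α e a.castSucc) (frameM φ C₁ α e b.castSucc)
    (fun y => Real.exp (φ y / 3) • e a y) (fun y => Real.exp (φ y / 3) • e b y)
    (circleVector α) _ _ (frameM_castSucc a) (frameM_castSucc b) (h.scaledFrame a)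
    (h.scaledFrame b) (hd a) (hd b) (differentiableAt_fieldInChart_circleVector h.volume z)
  have h2 := extD_one_apply h.form (h.scaledFrame a) (h.scaledFrame b)
  have h3 : extD C₁ x ![Real.exp (φ x / 3) • e a x, Real.exp (φ x / 3) • e b x] =
      Real.exp (2 * φ x / 3) * extD C₁ x ![e a x, e b x] := by
    have h4 := (extD C₁ x).map_smul_univ (fun _ => Real.exp (φ x / 3)) ![e a x, e b x]
    rw [Fin.prod_univ_two, exp_add_exp (show φ x / 3 + φ x / 3 = 2 * φ x / 3 by ring)] at h4
    refine Eq.trans ?_ h4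
    congr 1
    funext i
    fin_cases i <;> rfl
  rw [h3] at h2
  refine h1.trans (Prod.ext rfl ?_)
  refine congrArg (· • circleVector α z) ?_
  rw [h2, hc, hc]
  simp only
  ring

/-- The vertical vector has zero horizontal part, so only its coefficient e^{-2φ/3} is
differentiated, along e^{φ/3} e_a. -/
theorem mlieBracket_frameM_last (h : FrameData g φ C₁ α e x) (z : Circle) (a : Fin 10) :
    mlieBracket IM (frameM φ C₁ α e a.castSucc) (frameM φ C₁ α e (Fin.last 10)) (x, z) =
      pairVec (x, z) 0
      ((-2 / 3 * Real.exp (-φ x / 3) * mvfderiv (𝓡 10) φ x (e a x)) • circleVector α z) := by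
  have : IsManifold (𝓡 10) 1 N := .of_le (n := ∞) (by exact_mod_cast le_top)
  have hc : (fun y => Real.exp (φ y / 3) * covec C₁ y (e a y)) =
      fun y => covec C₁ y (Real.exp (φ y / 3) • e a y) := by
    funext y
    rw [map_smul, smul_eq_mul]
  have hd : MDifferentiableAt (𝓡 10) 𝓘(ℝ, ℝ)
      (fun y => Real.exp (φ y / 3) * covec C₁ y (e a y)) x := by
    rw [hc]
    exact mdifferentiableAt_covec_apply h.form (h.scaledFrame a)
  have h0 : MDifferentiableAt (𝓡 10) (𝓡 10).tangent
      (fun y => (⟨y, (0 : TangentSpace (𝓡 10) y)⟩ : TangentBundle (𝓡 10) N)) x :=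
    (Bundle.contMDiff_zeroSection ℝ (TangentSpace (𝓡 10) : N → Type _) (n := 1)
      |>.contMDiffAt).mdifferentiableAt one_ne_zero
  have h1 := mlieBracket_prod (x, z) (frameM φ C₁ α e a.castSucc) (frameM φ C₁ α e (Fin.last 10))
    (fun y => Real.exp (φ y / 3) • e a y) (fun y => (0 : TangentSpace (𝓡 10) y))
    (circleVector α) _ (fun y => Real.exp (-2 * φ y / 3)) (frameM_castSucc a) frameM_last
      (h.scaledFrame a)
    h0 hd h.exp_neg_two_thirds.1 (differentiableAt_fieldInChart_circleVector h.volume z)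
  refine h1.trans (Prod.ext ?_ ?_)
  · exact congrFun (mlieBracket_zero_right (I := 𝓡 10)) x
  · refine congrArg (· • circleVector α z) ?_
    simp only [map_zero, sub_zero, h.exp_neg_two_thirds.2, map_smul, smul_eq_mul]
    rw [← exp_add_exp (show -2 * φ x / 3 + φ x / 3 = -φ x / 3 by ring)]
    ring

theorem structCoeff_castSucc (h : FrameData g φ C₁ α e x) (z : Circle) (a b c : Fin 10) :
    structCoeff (metricM g φ C₁ α) (frameM φ C₁ α e) a.castSucc b.castSucc c.castSucc (x, z) =
      Real.exp (φ x / 3) * (structCoeff g e a b c x +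
        1 / 3 * mvfderiv (𝓡 10) φ x (e a x) * (if b = c then eta b else 0) -
        1 / 3 * mvfderiv (𝓡 10) φ x (e b x) * (if a = c then eta a else 0)) := by
  have ho := h.orthonormal.self_of_nhds
  rw [structCoeff, h.mlieBracket_frameM_castSucc, metricM_castSucc h.volume,
    h.mlieBracket_scaledFrame]
  simp only [map_smul, map_add, map_sub, _root_.smul_apply, _root_.add_apply, _root_.sub_apply,
    smul_eq_mul, ho _ c]
  rw [← mul_assoc, exp_add_exp (show -φ x / 3 + 2 * φ x / 3 = φ x / 3 by ring), structCoeff]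

/-- Pairing with e'₁₀ applies α - C₁, which removes the horizontal lift of the bracket and leaves
the curvature. -/
theorem structCoeff_castSucc_last (h : FrameData g φ C₁ α e x) (z : Circle) (a b : Fin 10) :
    structCoeff (metricM g φ C₁ α) (frameM φ C₁ α e) a.castSucc b.castSucc (Fin.last 10) (x, z) =
      Real.exp (4 * φ x / 3) * extD C₁ x ![e a x, e b x] := by
  rw [structCoeff, h.mlieBracket_frameM_castSucc, metricM_last h.volume, add_sub_cancel_left,
    ← mul_assoc, exp_add_exp (show 2 * φ x / 3 + 2 * φ x / 3 = 4 * φ x / 3 by ring)]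

theorem structCoeff_last_castSucc (h : FrameData g φ C₁ α e x) (z : Circle) (a b : Fin 10) :
    structCoeff (metricM g φ C₁ α) (frameM φ C₁ α e) a.castSucc (Fin.last 10) b.castSucc (x, z) =
      0 := by
  rw [structCoeff, h.mlieBracket_frameM_last, metricM_castSucc h.volume]
  simp

theorem structCoeff_last_last (h : FrameData g φ C₁ α e x) (z : Circle) (a : Fin 10) :
    structCoeff (metricM g φ C₁ α) (frameM φ C₁ α e) a.castSucc (Fin.last 10) (Fin.last 10)
      (x, z) = -2 / 3 * Real.exp (φ x / 3) * mvfderiv (𝓡 10) φ x (e a x) := by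
  rw [structCoeff, h.mlieBracket_frameM_last, metricM_last h.volume, map_zero, sub_zero,
    ← exp_add_exp (show 2 * φ x / 3 + -φ x / 3 = φ x / 3 by ring)]
  ring

end FrameData

end ReductionFrame

end IIA

namespace IIA

/-! ### Operator identities and the spin connection of M. -/

section Algebra

variable {R : Type*} [Ring R] [Algebra ℝ R]

/-- The algebra behind the reduction of the horizontal gravitino equation. -/
theorem gravitino_identity {c χ D G₂ H G₄ iG iH : R} {r E : ℝ} (hχ : χ * χ = 1)
    (hc : c * χ = -(χ * c)) (hD : χ * D = -(D * χ)) (hG₂ : χ * G₂ = G₂ * χ)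
    (hH : χ * H = -(H * χ)) (hG₄ : χ * G₄ = G₄ * χ)
    (hcD : c * D = -(D * c) + (2 * r) • 1) (hcG : c * G₂ = G₂ * c + (2 : ℝ) • iG)
    (hcH : c * H = -(H * c) + (2 : ℝ) • iH) :
    -((1 / 4 : ℝ) • ((1 / 3 : ℝ) • (c * D - D * c) + E • (iG * χ))) +
        (1 / 24 : ℝ) • ((3 : ℝ) • ((E • G₄ - χ * H) * c) - c * (E • G₄ - χ * H)) =
      (r / 6) • 1 - (1 / 4 : ℝ) • (iH * χ) +
        (1 / 8 * E) • (G₄ * c + G₂ * (c * χ)) -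
        (1 / 2 : ℝ) • (c * χ * ((1 / 4 * E) • G₂ - (1 / 3 : ℝ) • (D * χ) +
          (1 / 12 * E) • (G₄ * χ) + (1 / 6 : ℝ) • H)) := by
  -- The contractions are eliminated through (anti)commutators with c. Once every χ has been moved
  -- to the right and D c reordered, both sides are combinations of the same words and coefficients
  -- can be compared.
  have hiG : iG = (1 / 2 : ℝ) • (c * G₂ - G₂ * c) := by rw [hcG]; module
  have hiH : iH = (1 / 2 : ℝ) • (c * H + H * c) := by rw [hcH]; module
  have hDc : D * c = -(c * D) + (2 * r) • 1 := by rw [hcD]; module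
  have e1 : χ * H * c = H * c * χ := by
    rw [hH, neg_mul, mul_assoc, mul_assoc H c, hc, mul_neg]
  have e2 : c * (χ * H) = -(c * H * χ) := by rw [hH, mul_neg, mul_assoc]
  have e3 : c * χ * G₂ = c * G₂ * χ := by rw [mul_assoc, hG₂, mul_assoc]
  have e4 : c * χ * (D * χ) = -(c * D) := by
    rw [mul_assoc, ← mul_assoc χ, hD, neg_mul, mul_assoc D, hχ, mul_one, mul_neg]
  have e5 : c * χ * (G₄ * χ) = c * G₄ := by
    rw [mul_assoc, ← mul_assoc χ, hG₄, mul_assoc G₄, hχ, mul_one]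
  have e6 : c * χ * H = -(c * H * χ) := by rw [mul_assoc, e2]
  simp only [hiG, hiH, mul_add, mul_sub, sub_mul, add_mul, smul_mul_assoc, mul_smul_comm, e1, e2,
    e3, e4, e5, e6, hDc, ← mul_assoc]
  module

/-- The algebra behind the reduction of the vertical gravitino equation. -/
theorem dilatino_identity {χ D G₂ H G₄ : R} {E : ℝ} (hχ : χ * χ = 1)
    (hH : χ * H = -(H * χ)) (hG₄ : χ * G₄ = G₄ * χ) :
    -((1 / 4 : ℝ) • (-(E • G₂) + (4 / 3 : ℝ) • (D * χ))) +
        (1 / 24 : ℝ) • ((3 : ℝ) • ((E • G₄ - χ * H) * χ) - χ * (E • G₄ - χ * H)) =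
      (1 / 4 * E) • G₂ - (1 / 3 : ℝ) • (D * χ) + (1 / 12 * E) • (G₄ * χ) + (1 / 6 : ℝ) • H := by
  have e1 : χ * H * χ = -H := by rw [hH, neg_mul, mul_assoc, hχ, mul_one]
  have e2 : χ * (χ * H) = H := by rw [← mul_assoc, hχ, one_mul]
  simp only [mul_sub, sub_mul, smul_mul_assoc, mul_smul_comm, e1, e2, hG₄]
  module

end Algebra

theorem formMul_dFun {E : Type*} [NormedAddCommGroup E] [NormedSpace ℝ E] {H : Type*}
    [TopologicalSpace H] {I : ModelWithCorners ℝ E H} {M : Type*} [TopologicalSpace M]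
    [ChartedSpace H M] {n : ℕ} (Γ : GammaMatrices n)
    (e : Fin (n + 1) → ∀ x : M, TangentSpace I x) (f : M → ℝ) (x : M) :
    formMul Γ e (dFun I f) x = ∑ a, mvfderiv I f x (e a x) • Γ.raise a := by
  rw [formMul, GammaMatrices.form_one]
  rfl

namespace FrameData

open VectorField Set Filter Topology GammaMatrices

variable {N : Type*} [TopologicalSpace N] [ChartedSpace (EuclideanSpace ℝ (Fin 10)) N]
  {g : BilinField (𝓡 10) N} {φ : N → ℝ} {C₁ : DiffForm (𝓡 10) N 1}
  {α : DiffForm (𝓡 1) Circle 1} {e : Fin 10 → ∀ x : N, TangentSpace (𝓡 10) x}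
  [IsManifold (𝓡 10) ∞ N] {x : N}

/-- These are the connection coefficients of the conformally rescaled metric e^{-2φ/3} g in the
frame e^{φ/3} e_a; C₁ does not enter. -/
theorem koszul_horizontal (h : FrameData g φ C₁ α e x) (z : Circle) (c a b : Fin 10) :
    koszul (metricM g φ C₁ α) (frameM φ C₁ α e c.castSucc) (frameM φ C₁ α e a.castSucc)
      (frameM φ C₁ α e b.castSucc) (x, z) =
    Real.exp (φ x / 3) * (koszul g (e c) (e a) (e b) x + 1 / 3 *
      (mvfderiv (𝓡 10) φ x (e b x) * (if a = c then eta c else 0) -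
        mvfderiv (𝓡 10) φ x (e a x) * (if b = c then eta c else 0))) := by
  rw [koszul_eq_structCoeff (h.orthonormalM z), koszul_eq_structCoeff h.orthonormal,
    h.structCoeff_castSucc, h.structCoeff_castSucc, h.structCoeff_castSucc]
  have hs (a b : Fin 10) : (if a = b then eta (n := 9) a else 0) = if b = a then eta b else 0 := by
    by_cases hab : a = b
    · subst hab; rfl
    · simp [hab, Ne.symm hab]
  -- The Kronecker symbols are brought to a common form, with η_c as the value, so that `ring` can
  -- identify them.
  rw [hs c a, hs c b, hs b a]
  have ha (a : Fin 10) : (if a = c then eta (n := 9) a else 0) = if a = c then eta c else 0 := by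
    by_cases hac : a = c
    · subst hac; rfl
    · simp [hac]
  rw [ha, ha]
  ring

theorem koszul_horizontal_last (h : FrameData g φ C₁ α e x) (z : Circle) (c a : Fin 10) :
    koszul (metricM g φ C₁ α) (frameM φ C₁ α e c.castSucc) (frameM φ C₁ α e a.castSucc)
      (frameM φ C₁ α e (Fin.last 10)) (x, z) =
    1 / 2 * Real.exp (4 * φ x / 3) * extD C₁ x ![e c x, e a x] := by
  rw [koszul_eq_structCoeff (h.orthonormalM z), h.structCoeff_castSucc_last,
    h.structCoeff_last_castSucc, h.structCoeff_last_castSucc]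
  ring

theorem koszul_vertical (h : FrameData g φ C₁ α e x) (z : Circle) (a b : Fin 10) :
    koszul (metricM g φ C₁ α) (frameM φ C₁ α e (Fin.last 10)) (frameM φ C₁ α e a.castSucc)
      (frameM φ C₁ α e b.castSucc) (x, z) =
    -(1 / 2 * Real.exp (4 * φ x / 3) * extD C₁ x ![e a x, e b x]) := by
  rw [koszul_eq_structCoeff (h.orthonormalM z), structCoeff_swap _ _ (Fin.last 10),
    structCoeff_swap _ _ (Fin.last 10), h.structCoeff_castSucc_last,
    h.structCoeff_last_castSucc, h.structCoeff_last_castSucc]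
  ring

theorem koszul_vertical_last (h : FrameData g φ C₁ α e x) (z : Circle) (a : Fin 10) :
    koszul (metricM g φ C₁ α) (frameM φ C₁ α e (Fin.last 10)) (frameM φ C₁ α e a.castSucc)
      (frameM φ C₁ α e (Fin.last 10)) (x, z) =
    2 / 3 * Real.exp (φ x / 3) * mvfderiv (𝓡 10) φ x (e a x) := by
  have h0 : structCoeff (metricM g φ C₁ α) (frameM φ C₁ α e) (Fin.last 10) (Fin.last 10)
      a.castSucc (x, z) = 0 := by
    linarith [structCoeff_swap (metricM g φ C₁ α) (frameM φ C₁ α e) (Fin.last 10) (Fin.last 10)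
      a.castSucc (x, z)]
  rw [koszul_eq_structCoeff (h.orthonormalM z), h0, structCoeff_swap _ _ (Fin.last 10),
    h.structCoeff_last_last]
  ring

variable (Γ : GammaMatrices 9)

/-- The coefficients -(1/2) e^{4φ/3} (G₂)_{ab} sum to -e^{4φ/3} G₂. The change of the fibre length
contributes 2/3 from each of two mixed index orders, hence 4/3. -/
theorem sum_koszul_vertical (h : FrameData g φ C₁ α e x) (z : Circle) :
    ∑ a, ∑ b, koszul (metricM g φ C₁ α) (frameM φ C₁ α e (Fin.last 10)) (frameM φ C₁ α e a)
      (frameM φ C₁ α e b) (x, z) • Γ.extend.up ![a, b] =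
    Real.exp (φ x / 3) • (-(Real.exp (φ x) • formMul Γ e (extD C₁) x) +
      (4 / 3 : ℝ) • (formMul Γ e (dFun (𝓡 10) φ) x * Γ.chirality)) := by
  rw [sum_extend _ _ fun a b => koszul_antisymm (h.orthonormalM z) _ a b]
  simp only [h.koszul_vertical, h.koszul_vertical_last]
  rw [formMul_dFun, formMul, form_two, smul_add, smul_neg, smul_smul (Real.exp _),
    exp_add_exp (show φ x / 3 + φ x = 4 * φ x / 3 by ring)]
  simp only [mul_smul, ← Finset.smul_sum, neg_smul, Finset.sum_neg_distrib, smul_mul_assoc]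
  refine congrArg₂ _ ?_ ?_
  · rw [smul_comm (Real.exp _), one_div]
    rfl
  · module

/-- The conformal factor contributes the commutator of Γ_c with dφ. The curvature enters through the
mixed indices, counted twice with coefficient 1/2. -/
theorem sum_koszul_horizontal (h : FrameData g φ C₁ α e x) (z : Circle) (c : Fin 10) :
    ∑ a, ∑ b, koszul (metricM g φ C₁ α) (frameM φ C₁ α e c.castSucc) (frameM φ C₁ α e a)
      (frameM φ C₁ α e b) (x, z) • Γ.extend.up ![a, b] =
    Real.exp (φ x / 3) • (∑ a, ∑ b, koszul g (e c) (e a) (e b) x • Γ.up ![a, b] +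
      ((1 / 3 : ℝ) • (Γ c * formMul Γ e (dFun (𝓡 10) φ) x -
        formMul Γ e (dFun (𝓡 10) φ) x * Γ c) +
      Real.exp (φ x) • (contrMul Γ e (extD C₁) x (e c x) * Γ.chirality))) := by
  rw [sum_extend _ _ fun a b => koszul_antisymm (h.orthonormalM z) _ a b,
    sum_up_two _ _ fun a b => koszul_antisymm h.orthonormal _ a b]
  simp only [h.koszul_horizontal, h.koszul_horizontal_last]
  have h1 : contrMul Γ e (extD C₁) x (e c x) =
      ∑ a, extD C₁ x ![e c x, e a x] • Γ.raise a := by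
    rw [contrMul, form_curryLeft_two]
    rfl
  -- Γ_c = η_c Γ^c is written as a sum over a Kronecker symbol, to match the double sum of
  -- connection coefficients.
  have h2 : Γ c * formMul Γ e (dFun (𝓡 10) φ) x = ∑ a, ∑ b, (mvfderiv (𝓡 10) φ x (e b x) *
      (if a = c then eta c else 0)) • (Γ.raise a * Γ.raise b) := by
    rw [formMul_dFun, ← eta_smul_raise, smul_mul_assoc, Finset.mul_sum, Finset.smul_sum]
    simp only [mul_ite, mul_zero, ite_smul, zero_smul]
    rw [Finset.sum_comm]
    simp only [Finset.sum_ite_eq', Finset.mem_univ, if_true]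
    refine Finset.sum_congr rfl fun b _ => ?_
    rw [mul_smul_comm, smul_smul, mul_comm]
  have h3 : formMul Γ e (dFun (𝓡 10) φ) x * Γ c = ∑ a, ∑ b, (mvfderiv (𝓡 10) φ x (e a x) *
      (if b = c then eta c else 0)) • (Γ.raise a * Γ.raise b) := by
    rw [formMul_dFun, ← eta_smul_raise, mul_smul_comm, Finset.sum_mul, Finset.smul_sum]
    simp only [mul_ite, mul_zero, ite_smul, zero_smul]
    simp only [Finset.sum_ite_eq', Finset.mem_univ, if_true]
    refine Finset.sum_congr rfl fun b _ => ?_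
    rw [smul_mul_assoc, smul_smul, mul_comm]
  rw [h1, h2, h3, ← Finset.sum_sub_distrib]
  simp only [← Finset.sum_sub_distrib, ← sub_smul]
  rw [smul_add, smul_add, smul_smul (Real.exp _) (Real.exp _),
    exp_add_exp (show φ x / 3 + φ x = 4 * φ x / 3 by ring), ← add_assoc, ← smul_add]
  refine congrArg₂ _ ?_ ?_
  · simp only [Finset.smul_sum, ← Finset.sum_add_distrib]
    refine Finset.sum_congr rfl fun a _ => Finset.sum_congr rfl fun b _ => ?_
    module
  · simp only [mul_smul, ← Finset.smul_sum, smul_mul_assoc]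
    module

end FrameData

end IIA

namespace IIA

/-! ### The field strength G in the frame e'. -/

section FieldStrength

open GammaMatrices

variable {N : Type*} [TopologicalSpace N] [ChartedSpace (EuclideanSpace ℝ (Fin 10)) N]
  [IsManifold (𝓡 10) ∞ N]
  {φ : N → ℝ} {C₁ : DiffForm (𝓡 10) N 1} {B₂ : DiffForm (𝓡 10) N 2} {C₃ : DiffForm (𝓡 10) N 3}
  {α : DiffForm (𝓡 1) Circle 1}

theorem apply_smul_const {E : Type*} [NormedAddCommGroup E] [NormedSpace ℝ E] {k : ℕ}
    (F : E [⋀^Fin k]→L[ℝ] ℝ) (r : ℝ) (v : Fin k → E) :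
    F (fun i => r • v i) = r ^ k * F v := by
  have := F.map_smul_univ (fun _ => r) v
  rwa [Finset.prod_const, Finset.card_univ, Fintype.card_fin] at this

/-- On horizontal lifts α takes the values of C₁, so dC₃ - α ∧ dB₂ becomes dC₃ - C₁ ∧ dB₂; this is
why G̃₄ appears. Each of the four arguments contributes e^{φ/3}. -/
theorem extD_threeFormM_horizontal (hB₂ : SmoothForm B₂) (hC₃ : SmoothForm C₃)
    (hα : IsInvariantVolumeForm α) (e : Fin 10 → ∀ x : N, TangentSpace (𝓡 10) x) (p : N × Circle)
    (a : Fin 4 → Fin 10) :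
    extD (threeFormM B₂ C₃ α) p (fun j => frameM φ C₁ α e (a j).castSucc p) =
      Real.exp (4 * φ p.1 / 3) * fieldStrength4 C₁ B₂ C₃ p.1 (fun j => e (a j) p.1) := by
  have h1 : fieldStrength4 C₁ B₂ C₃ p.1 (fun j => e (a j) p.1) =
      extD C₃ p.1 (fun j => e (a j) p.1) - ∑ i : Fin 4, (-1 : ℝ) ^ (i : ℕ) *
        (covec C₁ p.1 (e (a i) p.1) * extD B₂ p.1 (fun j => e (a (i.succAbove j)) p.1)) :=
    congrArg (extD C₃ p.1 (fun j => e (a j) p.1) - ·)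
      (covecWedge_apply (V := EuclideanSpace ℝ (Fin 10)) (covec C₁ p.1) (extD B₂ p.1)
        (fun j => e (a j) p.1))
  have h4 : Real.exp (φ p.1 / 3) ^ 4 = Real.exp (4 * φ p.1 / 3) := by
    rw [← Real.exp_nat_mul]; congr 1; push_cast; ring
  simp only [frameM_castSucc]
  rw [extD_threeFormM hB₂ hC₃ hα.smooth, h1, mul_sub, Finset.mul_sum]
  refine congrArg₂ _ ?_ (Finset.sum_congr rfl fun i _ => ?_)
  · rw [← h4]
    exact apply_smul_const (E := EuclideanSpace ℝ (Fin 10)) _ _ _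
  · have h3 : extD B₂ p.1 (fun j => Real.exp (φ p.1 / 3) • e (a (i.succAbove j)) p.1) =
        Real.exp (φ p.1 / 3) ^ 3 * extD B₂ p.1 (fun j => e (a (i.succAbove j)) p.1) :=
      apply_smul_const (E := EuclideanSpace ℝ (Fin 10)) _ _ _
    rw [h3, map_smul, covec_circleVector hα, ← h4, smul_eq_mul]
    ring

/-- Only the summand in which α receives the vertical vector survives: in all others a form pulled
back from N is fed a vector with zero N-component. The weight is e^{-2φ/3} times three factors
e^{φ/3}. -/
theorem extD_threeFormM_vertical (hB₂ : SmoothForm B₂) (hC₃ : SmoothForm C₃)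
    (hα : IsInvariantVolumeForm α) (e : Fin 10 → ∀ x : N, TangentSpace (𝓡 10) x) (p : N × Circle)
    (a : Fin 3 → Fin 10) :
    extD (threeFormM B₂ C₃ α) p (Matrix.vecCons (frameM φ C₁ α e (Fin.last 10) p)
        (fun j => frameM φ C₁ α e (a j).castSucc p)) =
      -Real.exp (φ p.1 / 3) * extD B₂ p.1 (fun j => e (a j) p.1) := by
  have h0 : Matrix.vecCons (frameM φ C₁ α e (Fin.last 10) p)
        (fun j => frameM φ C₁ α e (a j).castSucc p) = fun i => pairVec p
        ((Fin.cons 0 fun j => Real.exp (φ p.1 / 3) • e (a j) p.1 :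
          Fin 4 → TangentSpace (𝓡 10) p.1) i)
        ((Fin.cons (Real.exp (-2 * φ p.1 / 3) • circleVector α p.2) fun j =>
          (Real.exp (φ p.1 / 3) * covec C₁ p.1 (e (a j) p.1)) • circleVector α p.2 :
          Fin 4 → TangentSpace (𝓡 1) p.2) i) := by
    funext i
    refine Fin.cases ?_ (fun j => ?_) i
    · exact frameM_last (C₁ := C₁) (e := e) p
    · exact frameM_castSucc (a j) p
  have hz {k : ℕ} (F : EuclideanSpace ℝ (Fin 10) [⋀^Fin (k + 1)]→L[ℝ] ℝ)
      (v : Fin (k + 1) → EuclideanSpace ℝ (Fin 10)) (hv : v 0 = 0) : F v = 0 :=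
    F.map_coord_zero 0 hv
  rw [h0, extD_threeFormM hB₂ hC₃ hα.smooth, Fin.sum_univ_succ]
  have h1 : extD C₃ p.1 (Fin.cons 0 fun j => Real.exp (φ p.1 / 3) • e (a j) p.1) = 0 :=
    hz _ _ rfl
  have h2 (i : Fin 3) : extD B₂ p.1 (fun j => (Fin.cons 0 fun j => Real.exp (φ p.1 / 3) • e (a j)
      p.1 :
          Fin 4 → TangentSpace (𝓡 10) p.1) (i.succ.succAbove j)) = 0 :=
    hz _ _ (by rw [Fin.succ_succAbove_zero]; rfl)
  have h3 : extD B₂ p.1 (fun j => (Fin.cons 0 fun j => Real.exp (φ p.1 / 3) • e (a j) p.1 :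
          Fin 4 → TangentSpace (𝓡 10) p.1) (Fin.succAbove 0 j)) =
      Real.exp (φ p.1 / 3) ^ 3 * extD B₂ p.1 (fun j => e (a j) p.1) :=
    apply_smul_const (E := EuclideanSpace ℝ (Fin 10)) _ _ _
  have h4 : Real.exp (-2 * φ p.1 / 3) * Real.exp (φ p.1 / 3) ^ 3 = Real.exp (φ p.1 / 3) := by
    rw [← Real.exp_nat_mul, ← Real.exp_add]; congr 1; push_cast; ring
  simp only [h1, h2, h3, mul_zero, Finset.sum_const_zero, add_zero, Fin.val_zero, pow_zero, one_mul,
    Fin.cons_zero, map_smul,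
    covec_circleVector hα, smul_eq_mul, mul_one, zero_sub]
  rw [← mul_assoc, h4, neg_mul]

theorem formMul_extD_threeFormM (Γ : GammaMatrices 9) (hB₂ : SmoothForm B₂) (hC₃ : SmoothForm C₃)
    (hα : IsInvariantVolumeForm α) (e : Fin 10 → ∀ x : N, TangentSpace (𝓡 10) x)
    (p : N × Circle) :
    formMul Γ.extend (frameM φ C₁ α e) (extD (threeFormM B₂ C₃ α)) p =
      Real.exp (φ p.1 / 3) • (Real.exp (φ p.1) • formMul Γ e (fieldStrength4 C₁ B₂ C₃) p.1 -
        Γ.chirality * formMul Γ e (extD B₂) p.1) := by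
  rw [formMul, form_extend, form_of_eq_smul Γ (e := fun a => e a p.1)
    (F := (fieldStrength4 C₁ B₂ C₃ p.1).toAlternatingMap) _
    (extD_threeFormM_horizontal hB₂ hC₃ hα e p), form_of_eq_smul Γ (e := fun a => e a p.1)
    (F := (extD B₂ p.1).toAlternatingMap) _ (extD_threeFormM_vertical hB₂ hC₃ hα e p),
    ← exp_add_exp (show φ p.1 / 3 + φ p.1 = 4 * φ p.1 / 3 by ring)]
  simp only [neg_smul, mul_neg, mul_smul_comm, smul_sub, mul_smul]
  exact (sub_eq_add_neg _ _).symm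

end FieldStrength

end IIA

namespace IIA

/-! ### The two components of the eleven-dimensional equation. -/

section Killing

open GammaMatrices

variable {N : Type*} [TopologicalSpace N] [ChartedSpace (EuclideanSpace ℝ (Fin 10)) N]
  {g : BilinField (𝓡 10) N} {φ : N → ℝ} {C₁ : DiffForm (𝓡 10) N 1}
  {B₂ : DiffForm (𝓡 10) N 2} {C₃ : DiffForm (𝓡 10) N 3} {α : DiffForm (𝓡 1) Circle 1}
  {e : Fin 10 → ∀ x : N, TangentSpace (𝓡 10) x} {δ ε : N → Spinor} {x : N}

theorem mvfderiv_comp_fst (hδ : MDifferentiableAt (𝓡 10) 𝓘(ℝ, Spinor) δ x) (z : Circle)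
    (X : TangentSpace (𝓡 10) x) (S : TangentSpace (𝓡 1) z) :
    mvfderiv IM (fun p : N × Circle => δ p.1) (x, z) (pairVec (x, z) X S) =
      mvfderiv (𝓡 10) δ x X := by
  have h := mfderiv_comp (I := IM) (x, z) (f := (Prod.fst : N × Circle → N)) (g := δ) hδ
    mdifferentiableAt_fst
  rw [mfderiv_fst] at h
  exact congrArg (fun L => L (pairVec (x, z) X S)) h

variable [IsManifold (𝓡 10) ∞ N]

/-- The term dφ(v)/6 is the one that absorbs the scalar left over in `gravitino_identity`; it fixes
the exponent of the rescaling. -/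
theorem mvfderiv_exp_smul (hφ : MDifferentiableAt (𝓡 10) 𝓘(ℝ, ℝ) φ x)
    (hδ : MDifferentiableAt (𝓡 10) 𝓘(ℝ, Spinor) δ x)
    (hε : ∀ y, ε y = Real.exp (φ y / 6) • δ y) (v : TangentSpace (𝓡 10) x) :
    mvfderiv (𝓡 10) ε x v = Real.exp (φ x / 6) •
      (mvfderiv (𝓡 10) δ x v + (mvfderiv (𝓡 10) φ x v / 6) • δ x) := by
  have h1 := mvfderiv_exp_mul hφ (1 / 6)
  simp only [one_div_mul_eq_div] at h1
  have h2 : ε = (fun y => Real.exp (φ y / 6)) • δ := funext hε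
  rw [h2, mvfderiv_smul h1.1 hδ]
  refine (congrArg (fun t : ℝ => Real.exp (φ x / 6) • mvfderiv (𝓡 10) δ x v + t • δ x)
    (h1.2 v)).trans ?_
  module

namespace FrameData

variable (Γ : GammaMatrices 9)

/-- The pulled-back spinor is constant along the fibre, so no derivative survives and the equation
is algebraic. -/
theorem gravitino11_vertical (h : FrameData g φ C₁ α e x) (hB₂ : SmoothForm B₂)
    (hC₃ : SmoothForm C₃) (hδ : MDifferentiableAt (𝓡 10) 𝓘(ℝ, Spinor) δ x)
    (hε : ∀ y, ε y = Real.exp (φ y / 6) • δ y) (z : Circle) :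
    Real.exp (φ x / 6) • gravitino11 Γ.extend (metricM g φ C₁ α) (frameM φ C₁ α e)
      (extD (threeFormM B₂ C₃ α)) (fun p => δ p.1) (x, z) (frameM φ C₁ α e (Fin.last 10) (x, z)) =
    Real.exp (φ x / 3) •
      dilatino Γ e φ (extD C₁) (extD B₂) (fieldStrength4 C₁ B₂ C₃) ε x := by
  have ho := (h.orthonormalM z).self_of_nhds
  have hd : mvfderiv IM (fun p : N × Circle => δ p.1) (x, z)
      (frameM φ C₁ α e (Fin.last 10) (x, z)) = 0 := by
    rw [frameM_last, mvfderiv_comp_fst hδ, map_zero]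
  rw [gravitino11, spinDeriv_frame _ ho, vecMul_frame _ ho, extend_last,
    h.sum_koszul_vertical, formMul_extD_threeFormM Γ hB₂ hC₃ h.volume, hd, dilatino, hε,
    ← dilatino_identity Γ.chirality_sq]
  · simp only [Matrix.add_mulVec, Matrix.sub_mulVec, Matrix.neg_mulVec, Matrix.smul_mulVec,
      Matrix.mulVec_sub, Matrix.mulVec_smul, Matrix.mulVec_mulVec]
    simp only [mul_sub, mul_smul_comm, Matrix.sub_mulVec, Matrix.smul_mulVec, sub_mul,
      smul_mul_assoc]
    module
  · have := chirality_mul_form Γ (fun a => e a x) (extD B₂ x).toAlternatingMap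
    rwa [show ((-1 : ℝ) ^ 3) = -1 by norm_num, neg_one_smul] at this
  · have := chirality_mul_form Γ (fun a => e a x) (fieldStrength4 C₁ B₂ C₃ x).toAlternatingMap
    rwa [show ((-1 : ℝ) ^ 4) = 1 by norm_num, one_smul] at this

/-- An identity with no equation assumed: the dilatino term accounts precisely for the excess of the
eleven-dimensional operator over the ten-dimensional one. -/
theorem gravitino11_horizontal (h : FrameData g φ C₁ α e x) (hB₂ : SmoothForm B₂)
    (hC₃ : SmoothForm C₃) (hδ : MDifferentiableAt (𝓡 10) 𝓘(ℝ, Spinor) δ x)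
    (hε : ∀ y, ε y = Real.exp (φ y / 6) • δ y) (z : Circle) (c : Fin 10) :
    Real.exp (φ x / 6) • gravitino11 Γ.extend (metricM g φ C₁ α) (frameM φ C₁ α e)
      (extD (threeFormM B₂ C₃ α)) (fun p => δ p.1) (x, z) (frameM φ C₁ α e c.castSucc (x, z)) =
    Real.exp (φ x / 3) •
      (gravitino Γ g e φ (extD C₁) (extD B₂) (fieldStrength4 C₁ B₂ C₃) ε x (e c x) -
        (1 / 2 : ℝ) • ((Γ c * Γ.chirality) *ᵥ
          dilatino Γ e φ (extD C₁) (extD B₂) (fieldStrength4 C₁ B₂ C₃) ε x)) := by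
  have hoM := (h.orthonormalM z).self_of_nhds
  have ho := h.orthonormal.self_of_nhds
  have hd : mvfderiv IM (fun p : N × Circle => δ p.1) (x, z)
      (frameM φ C₁ α e c.castSucc (x, z)) = Real.exp (φ x / 3) • mvfderiv (𝓡 10) δ x (e c x) := by
    rw [frameM_castSucc, mvfderiv_comp_fst hδ, map_smul]
  have hD : Γ.chirality * formMul Γ e (dFun (𝓡 10) φ) x =
      -(formMul Γ e (dFun (𝓡 10) φ) x * Γ.chirality) := by
    have := chirality_mul_form Γ (fun a => e a x) (dFun (𝓡 10) φ x).toAlternatingMap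
    rwa [pow_one, neg_one_smul] at this
  have hG₂ : Γ.chirality * formMul Γ e (extD C₁) x = formMul Γ e (extD C₁) x * Γ.chirality := by
    have := chirality_mul_form Γ (fun a => e a x) (extD C₁ x).toAlternatingMap
    rwa [show ((-1 : ℝ) ^ 2) = 1 by norm_num, one_smul] at this
  have hH : Γ.chirality * formMul Γ e (extD B₂) x =
      -(formMul Γ e (extD B₂) x * Γ.chirality) := by
    have := chirality_mul_form Γ (fun a => e a x) (extD B₂ x).toAlternatingMap
    rwa [show ((-1 : ℝ) ^ 3) = -1 by norm_num, neg_one_smul] at this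
  have hG₄ : Γ.chirality * formMul Γ e (fieldStrength4 C₁ B₂ C₃) x =
      formMul Γ e (fieldStrength4 C₁ B₂ C₃) x * Γ.chirality := by
    have := chirality_mul_form Γ (fun a => e a x) (fieldStrength4 C₁ B₂ C₃ x).toAlternatingMap
    rwa [show ((-1 : ℝ) ^ 4) = 1 by norm_num, one_smul] at this
  have hcD : Γ c * formMul Γ e (dFun (𝓡 10) φ) x = -(formMul Γ e (dFun (𝓡 10) φ) x * Γ c) +
      (2 * mvfderiv (𝓡 10) φ x (e c x)) • 1 := by
    have := mul_form Γ (fun a => e a x) c (dFun (𝓡 10) φ x).toAlternatingMap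
    rw [show ((-1 : ℝ) ^ (0 + 1)) = -1 by norm_num, neg_one_smul, form_zero_left,
      smul_smul] at this
    exact this
  have hcG : Γ c * formMul Γ e (extD C₁) x = formMul Γ e (extD C₁) x * Γ c +
      (2 : ℝ) • contrMul Γ e (extD C₁) x (e c x) := by
    have := mul_form Γ (fun a => e a x) c (extD C₁ x).toAlternatingMap
    rwa [show ((-1 : ℝ) ^ (1 + 1)) = 1 by norm_num, one_smul] at this
  have hcH : Γ c * formMul Γ e (extD B₂) x = -(formMul Γ e (extD B₂) x * Γ c) +
      (2 : ℝ) • contrMul Γ e (extD B₂) x (e c x) := by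
    have := mul_form Γ (fun a => e a x) c (extD B₂ x).toAlternatingMap
    rwa [show ((-1 : ℝ) ^ (2 + 1)) = -1 by norm_num, neg_one_smul] at this
  have key := congrArg (fun A : Mat => A *ᵥ δ x) (gravitino_identity (E := Real.exp (φ x))
    Γ.chirality_sq (Γ.chirality_anticomm c) hD hG₂ hH hG₄ hcD hcG hcH)
  -- The covariant derivative on N is separated from the algebraic remainder, which then has
  -- literally the left-hand shape of `gravitino_identity`.
  have hL : gravitino11 Γ.extend (metricM g φ C₁ α) (frameM φ C₁ α e)
      (extD (threeFormM B₂ C₃ α)) (fun p => δ p.1) (x, z) (frameM φ C₁ α e c.castSucc (x, z)) =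
      Real.exp (φ x / 3) • (mvfderiv (𝓡 10) δ x (e c x) -
        (1 / 4 : ℝ) • ((∑ a, ∑ b, koszul g (e c) (e a) (e b) x • Γ.up ![a, b]) *ᵥ δ x) +
        (-((1 / 4 : ℝ) • ((1 / 3 : ℝ) • (Γ c * formMul Γ e (dFun (𝓡 10) φ) x -
            formMul Γ e (dFun (𝓡 10) φ) x * Γ c) +
            Real.exp (φ x) • (contrMul Γ e (extD C₁) x (e c x) * Γ.chirality))) +
          (1 / 24 : ℝ) • ((3 : ℝ) • ((Real.exp (φ x) • formMul Γ e (fieldStrength4 C₁ B₂ C₃) x -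
            Γ.chirality * formMul Γ e (extD B₂) x) * Γ c) -
            Γ c * (Real.exp (φ x) • formMul Γ e (fieldStrength4 C₁ B₂ C₃) x -
            Γ.chirality * formMul Γ e (extD B₂) x))) *ᵥ δ x) := by
    rw [gravitino11, spinDeriv_frame _ hoM, vecMul_frame _ hoM, extend_castSucc,
      h.sum_koszul_horizontal, formMul_extD_threeFormM Γ hB₂ hC₃ h.volume, hd]
    simp only [Matrix.add_mulVec, Matrix.sub_mulVec, Matrix.neg_mulVec, Matrix.smul_mulVec,
      Matrix.mulVec_sub, Matrix.mulVec_smul, Matrix.mulVec_mulVec, mul_smul_comm,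
      smul_mul_assoc, mul_sub, sub_mul, mul_assoc]
    module
  rw [hL, show _ *ᵥ δ x = _ from key, gravitino, spinDeriv_frame _ ho, vecMul_frame _ ho,
    mvfderiv_exp_smul h.scalar hδ hε, dilatino, hε]
  simp only [Matrix.add_mulVec, Matrix.sub_mulVec, Matrix.smul_mulVec, Matrix.one_mulVec,
    Matrix.mulVec_add, Matrix.mulVec_sub, Matrix.mulVec_smul, Matrix.mulVec_mulVec, mul_add,
      mul_sub, mul_smul_comm, mul_assoc]
  module

end FrameData

end Killing

end IIA

namespace IIA

/-! ### Linearity of the equations in the tangent vector. -/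

section Linearity

open GammaMatrices

theorem eq_zero_of_span_eq_top {V W ι : Type*} [AddCommGroup V] [Module ℝ V] [AddCommGroup W]
    [Module ℝ W] {f : V → W} (hf : IsLinearMap ℝ f) {v : ι → V}
    (hv : Submodule.span ℝ (Set.range v) = ⊤) (h : ∀ a, f (v a) = 0) (X : V) : f X = 0 := by
  have : hf.mk' f = 0 := LinearMap.ext_on_range hv h
  exact congrArg (fun L : V →ₗ[ℝ] W => L X) this

variable {E : Type*} [NormedAddCommGroup E] [NormedSpace ℝ E] {H : Type*} [TopologicalSpace H]
  {I : ModelWithCorners ℝ E H} {M : Type*} [TopologicalSpace M] [ChartedSpace H M] {n : ℕ}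

theorem isLinearMap_vecMul (Γ : GammaMatrices n) (g : BilinField I M)
    (e : Fin (n + 1) → ∀ x : M, TangentSpace I x) (x : M) : IsLinearMap ℝ (vecMul Γ g e x) where
  map_add X Y := by
    simp only [vecMul, map_add, _root_.add_apply, mul_add, add_smul, Finset.sum_add_distrib]
  map_smul r X := by
    simp only [vecMul, map_smul, _root_.smul_apply, smul_eq_mul, Finset.smul_sum, smul_smul,
      mul_left_comm]

theorem isLinearMap_contrMul (Γ : GammaMatrices n) (e : Fin (n + 1) → ∀ x : M, TangentSpace I x)
    {k : ℕ} (F : DiffForm I M (k + 1)) (x : M) : IsLinearMap ℝ (contrMul Γ e F x) where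
  map_add X Y := by
    rw [contrMul, map_add, form_add]
    rfl
  map_smul r X := by
    rw [contrMul, map_smul, form_smul]
    rfl

theorem isLinearMap_spinDeriv (Γ : GammaMatrices n) (g : BilinField I M)
    (e : Fin (n + 1) → ∀ x : M, TangentSpace I x) (ψ : M → Spinor) (x : M) :
    IsLinearMap ℝ (spinDeriv Γ g e ψ x) where
  map_add X Y := by
    simp only [spinDeriv, connForm, map_add, _root_.add_apply, mul_add, add_mul,
      add_smul, Finset.sum_add_distrib, smul_add]
    abel
  map_smul r X := by
    have h (a b : Fin (n + 1)) : connForm g e a b x (r • X) = r * connForm g e a b x X := by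
      simp only [connForm, map_smul, _root_.smul_apply, smul_eq_mul, Finset.mul_sum]
      exact Finset.sum_congr rfl fun c _ => by ring
    simp only [spinDeriv, h, map_smul, mul_smul, ← Finset.smul_sum, smul_sub]
    rw [smul_comm r]

theorem isLinearMap_gravitino11 (Γ : GammaMatrices 10) (g : BilinField I M)
    (e : Fin 11 → ∀ x : M, TangentSpace I x) (G : DiffForm I M 4) (ψ : M → Spinor) (x : M) :
    IsLinearMap ℝ (gravitino11 Γ g e G ψ x) where
  map_add X Y := by
    simp only [gravitino11, (isLinearMap_spinDeriv Γ g e ψ x).map_add,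
      (isLinearMap_vecMul Γ g e x).map_add, Matrix.add_mulVec, Matrix.mulVec_add]
    module
  map_smul r X := by
    simp only [gravitino11, (isLinearMap_spinDeriv Γ g e ψ x).map_smul,
      (isLinearMap_vecMul Γ g e x).map_smul, Matrix.smul_mulVec, Matrix.mulVec_smul]
    module

theorem isLinearMap_gravitino (Γ : GammaMatrices 9) (g : BilinField I M)
    (e : Fin 10 → ∀ x : M, TangentSpace I x) (φ : M → ℝ) (G₂ : DiffForm I M 2)
    (H₃ : DiffForm I M 3) (G₄ : DiffForm I M 4) (ψ : M → Spinor) (x : M) :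
    IsLinearMap ℝ (gravitino Γ g e φ G₂ H₃ G₄ ψ x) where
  map_add X Y := by
    simp only [gravitino, (isLinearMap_spinDeriv Γ g e ψ x).map_add,
      (isLinearMap_vecMul Γ g e x).map_add, (isLinearMap_contrMul Γ e H₃ x).map_add,
      Matrix.add_mulVec, Matrix.mulVec_add]
    module
  map_smul r X := by
    simp only [gravitino, (isLinearMap_spinDeriv Γ g e ψ x).map_smul,
      (isLinearMap_vecMul Γ g e x).map_smul, (isLinearMap_contrMul Γ e H₃ x).map_smul,
      Matrix.smul_mulVec, Matrix.mulVec_smul]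
    module

end Linearity

/-! ### Rescaling of spinor fields and the equivalence of the systems. -/

section Reduction

variable {N : Type*} [TopologicalSpace N] [ChartedSpace (EuclideanSpace ℝ (Fin 10)) N]
  {g : BilinField (𝓡 10) N} {φ : N → ℝ} {C₁ : DiffForm (𝓡 10) N 1}
  {B₂ : DiffForm (𝓡 10) N 2} {C₃ : DiffForm (𝓡 10) N 3} {α : DiffForm (𝓡 1) Circle 1}
  {e : Fin 10 → ∀ x : N, TangentSpace (𝓡 10) x} {δ ε : N → Spinor} {x : N}

variable {ι : Type*} {S : SpinFrames 9 (𝓡 10) N ι}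

theorem IsSpinorField.smul {f : N → ℝ} (hf : ContMDiff (𝓡 10) 𝓘(ℝ, ℝ) ∞ f)
    {ψ : ι → N → Spinor} (hψ : IsSpinorField S ψ) :
    IsSpinorField S fun i x => f x • ψ i x where
  smooth i := hf.contMDiffOn.smul (hψ.smooth i)
  compat i j x hx := by rw [hψ.compat i j x hx, Matrix.mulVec_smul]

/-- The factor is real, so antilinearity of σ does not alter it. -/
theorem IsMajorana.smul (f : N → ℝ) {σ : Spinor →ₛₗ[starRingEnd ℂ] Spinor}
    {ψ : ι → N → Spinor} (hψ : IsMajorana S σ ψ) : IsMajorana S σ fun i x => f x • ψ i x := by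
  intro i x hx
  have h := σ.map_smulₛₗ (f x : ℂ) (ψ i x)
  rwa [Complex.conj_ofReal, hψ i x hx, Complex.coe_smul] at h

theorem IsNonzero.smul {f : N → ℝ} (hf : ∀ x, f x ≠ 0) {ψ : ι → N → Spinor}
    (hψ : IsNonzero S ψ) : IsNonzero S fun i x => f x • ψ i x := by
  obtain ⟨i, x, hx, h⟩ := hψ
  exact ⟨i, x, hx, smul_ne_zero (hf x) h⟩

theorem contMDiff_exp_div (hφ : ContMDiff (𝓡 10) 𝓘(ℝ, ℝ) ∞ φ) (r : ℝ) :
    ContMDiff (𝓡 10) 𝓘(ℝ, ℝ) ∞ fun x => Real.exp (φ x / r) :=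
  (Real.contDiff_exp.comp (contDiff_id.div_const r)).contMDiff.comp hφ

variable [IsManifold (𝓡 10) ∞ N]

namespace FrameData

variable (Γ : GammaMatrices 9)

theorem gravitino11_vertical_eq_zero_iff (h : FrameData g φ C₁ α e x) (hB₂ : SmoothForm B₂)
    (hC₃ : SmoothForm C₃) (hδ : MDifferentiableAt (𝓡 10) 𝓘(ℝ, Spinor) δ x)
    (hε : ∀ y, ε y = Real.exp (φ y / 6) • δ y) (z : Circle) :
    gravitino11 Γ.extend (metricM g φ C₁ α) (frameM φ C₁ α e) (extD (threeFormM B₂ C₃ α))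
      (fun p => δ p.1) (x, z) (frameM φ C₁ α e (Fin.last 10) (x, z)) = 0 ↔
    dilatino Γ e φ (extD C₁) (extD B₂) (fieldStrength4 C₁ B₂ C₃) ε x = 0 := by
  rw [← smul_eq_zero_iff_right (Real.exp_pos (φ x / 6)).ne',
    h.gravitino11_vertical Γ hB₂ hC₃ hδ hε, smul_eq_zero_iff_right (Real.exp_pos _).ne']

theorem gravitino11_horizontal_eq_zero_iff (h : FrameData g φ C₁ α e x) (hB₂ : SmoothForm B₂)
    (hC₃ : SmoothForm C₃) (hδ : MDifferentiableAt (𝓡 10) 𝓘(ℝ, Spinor) δ x)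
    (hε : ∀ y, ε y = Real.exp (φ y / 6) • δ y) (z : Circle)
    (hd : dilatino Γ e φ (extD C₁) (extD B₂) (fieldStrength4 C₁ B₂ C₃) ε x = 0) (c : Fin 10) :
    gravitino11 Γ.extend (metricM g φ C₁ α) (frameM φ C₁ α e) (extD (threeFormM B₂ C₃ α))
      (fun p => δ p.1) (x, z) (frameM φ C₁ α e c.castSucc (x, z)) = 0 ↔
    gravitino Γ g e φ (extD C₁) (extD B₂) (fieldStrength4 C₁ B₂ C₃) ε x (e c x) = 0 := by
  rw [← smul_eq_zero_iff_right (Real.exp_pos (φ x / 6)).ne',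
    h.gravitino11_horizontal Γ hB₂ hC₃ hδ hε, smul_eq_zero_iff_right (Real.exp_pos _).ne', hd,
    Matrix.mulVec_zero, smul_zero, sub_zero]

/-- Both equations are linear in X, so it suffices to test them on the frames e' and e, which span.
The vertical vector has to be treated first, since the horizontal equivalence presupposes the
dilatino equation. -/
theorem gravitino11_eq_zero_iff (h : FrameData g φ C₁ α e x) (hB₂ : SmoothForm B₂)
    (hC₃ : SmoothForm C₃) (hδ : MDifferentiableAt (𝓡 10) 𝓘(ℝ, Spinor) δ x)
    (hε : ∀ y, ε y = Real.exp (φ y / 6) • δ y) (z : Circle) :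
    (∀ X, gravitino11 Γ.extend (metricM g φ C₁ α) (frameM φ C₁ α e) (extD (threeFormM B₂ C₃ α))
      (fun p => δ p.1) (x, z) X = 0) ↔
    dilatino Γ e φ (extD C₁) (extD B₂) (fieldStrength4 C₁ B₂ C₃) ε x = 0 ∧
      ∀ X, gravitino Γ g e φ (extD C₁) (extD B₂) (fieldStrength4 C₁ B₂ C₃) ε x X = 0 := by
  constructor
  · intro hX
    have hd := (h.gravitino11_vertical_eq_zero_iff Γ hB₂ hC₃ hδ hε z).1 (hX _)
    refine ⟨hd, eq_zero_of_span_eq_top (isLinearMap_gravitino Γ g e φ _ _ _ ε x)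
      (h.orthonormal.self_of_nhds.span_eq_top (by simp)) fun a => ?_⟩
    exact (h.gravitino11_horizontal_eq_zero_iff Γ hB₂ hC₃ hδ hε z hd a).1 (hX _)
  · rintro ⟨hd, hX⟩
    refine eq_zero_of_span_eq_top (isLinearMap_gravitino11 _ _ _ _ _ _)
      ((h.orthonormalM z).self_of_nhds.span_eq_top (by simp)) fun a => ?_
    refine Fin.lastCases ?_ (fun a => ?_) a
    · exact (h.gravitino11_vertical_eq_zero_iff Γ hB₂ hC₃ hδ hε z).2 hd
    · exact (h.gravitino11_horizontal_eq_zero_iff Γ hB₂ hC₃ hδ hε z hd a).2 (hX _)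

end FrameData

variable {Γ : GammaMatrices 9}

theorem IsSpinStructure.frameData (hS : IsSpinStructure Γ g S)
    (hφ : ContMDiff (𝓡 10) 𝓘(ℝ, ℝ) ∞ φ) (hC₁ : SmoothForm C₁) (hα : IsInvariantVolumeForm α)
    {i : ι} (hx : x ∈ S.dom i) : FrameData g φ C₁ α (S.frame i) x where
  orthonormal := by
    filter_upwards [(hS.isOpen i).mem_nhds hx] with y hy
    exact hS.orthonormal i y hy
  frame a := ((hS.smooth_frame i a).contMDiffAt ((hS.isOpen i).mem_nhds hx)).mdifferentiableAt
    (by simp)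
  scalar := hφ.mdifferentiableAt (by simp)
  form := hC₁
  volume := hα

theorem IsSpinorField.mdifferentiableAt (hS : IsSpinStructure Γ g S) {ψ : ι → N → Spinor}
    (hψ : IsSpinorField S ψ) {i : ι} (hx : x ∈ S.dom i) :
    MDifferentiableAt (𝓡 10) 𝓘(ℝ, Spinor) (ψ i) x :=
  ((hψ.smooth i).contMDiffAt ((hS.isOpen i).mem_nhds hx)).mdifferentiableAt (by simp)

theorem solvesKilling11_iff (hφ : ContMDiff (𝓡 10) 𝓘(ℝ, ℝ) ∞ φ) (hC₁ : SmoothForm C₁)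
    (hB₂ : SmoothForm B₂) (hC₃ : SmoothForm C₃) (hα : IsInvariantVolumeForm α)
    (hS : IsSpinStructure Γ g S) {δ ε : ι → N → Spinor} (hδ : IsSpinorField S δ)
    (hε : ∀ i x, ε i x = Real.exp (φ x / 6) • δ i x) :
    SolvesKilling11 Γ S g φ C₁ B₂ C₃ α δ ↔
      SolvesDilatino Γ S φ C₁ B₂ C₃ ε ∧ SolvesGravitino Γ S g φ C₁ B₂ C₃ ε := by
  have key (i : ι) (x : N) (hx : x ∈ S.dom i) :=
    (hS.frameData hφ hC₁ hα hx).gravitino11_eq_zero_iff Γ hB₂ hC₃ (hδ.mdifferentiableAt hS hx)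
      (hε i)
  constructor
  · intro h
    -- The equations on N do not involve the circle, so one point of it, here 1, is enough.
    exact ⟨fun i x hx => ((key i x hx 1).1 (h i x hx 1)).1,
      fun i x hx => ((key i x hx 1).1 (h i x hx 1)).2⟩
  · rintro ⟨hd, hg⟩ i x hx z
    exact (key i x hx z).2 ⟨hd i x hx, hg i x hx⟩

end Reduction

end IIA

end

/-! ### Assembly, with the statement on Majorana spinors. -/

theorem mainTheorem10
    {N : Type*} [TopologicalSpace N] [ChartedSpace (EuclideanSpace ℝ (Fin 10)) N]
    [IsManifold (𝓡 10) ∞ N]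
    (g : BilinField (𝓡 10) N) (hg : IsLorentzMetric 9 g)
    (φ : N → ℝ) (hφ : ContMDiff (𝓡 10) 𝓘(ℝ, ℝ) ∞ φ)
    (C₁ : DiffForm (𝓡 10) N 1) (hC₁ : SmoothForm C₁)
    (B₂ : DiffForm (𝓡 10) N 2) (hB₂ : SmoothForm B₂)
    (C₃ : DiffForm (𝓡 10) N 3) (hC₃ : SmoothForm C₃)
    (α : DiffForm (𝓡 1) Circle 1) (hα : IsInvariantVolumeForm α)
    (Γ : GammaMatrices 9) {ι : Type*} (S : SpinFrames 9 (𝓡 10) N ι)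
    (hS : IsSpinStructure Γ g S) :
    -- for every spinor field `δ` on `N` and `ε = e^{φ/6} δ`:
    (∀ δ : ι → N → Spinor, IsSpinorField S δ → ∀ ε : ι → N → Spinor,
      (∀ i x, ε i x = Real.exp (φ x / 6) • δ i x) →
      -- the equation for `X = e'₁₀` is the dilatino equation
      (∀ i, ∀ x ∈ S.dom i, ∀ z : Circle,
        gravitino11 Γ.extend (metricM g φ C₁ α) (frameM φ C₁ α (S.frame i))
            (extD (threeFormM B₂ C₃ α)) (fun p => δ i p.1) (x, z)
            (frameM φ C₁ α (S.frame i) (Fin.last 10) (x, z)) = 0 ↔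
          dilatino Γ (S.frame i) φ (extD C₁) (extD B₂) (fieldStrength4 C₁ B₂ C₃) (ε i) x = 0) ∧
      -- modulo the dilatino equation, the equation for `X = e'_a` is the gravitino equation
      (∀ i, ∀ x ∈ S.dom i, ∀ z : Circle,
        dilatino Γ (S.frame i) φ (extD C₁) (extD B₂) (fieldStrength4 C₁ B₂ C₃) (ε i) x = 0 →
        ∀ a : Fin 10,
          (gravitino11 Γ.extend (metricM g φ C₁ α) (frameM φ C₁ α (S.frame i))
              (extD (threeFormM B₂ C₃ α)) (fun p => δ i p.1) (x, z)
              (frameM φ C₁ α (S.frame i) a.castSucc (x, z)) = 0 ↔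
            gravitino Γ g (S.frame i) φ (extD C₁) (extD B₂) (fieldStrength4 C₁ B₂ C₃) (ε i) x
              (S.frame i a x) = 0)) ∧
      (SolvesKilling11 Γ S g φ C₁ B₂ C₃ α δ ↔
        SolvesDilatino Γ S φ C₁ B₂ C₃ ε ∧ SolvesGravitino Γ S g φ C₁ B₂ C₃ ε)) ∧
    -- existence of non-zero Majorana solutions
    (∀ σ : Spinor →ₛₗ[starRingEnd ℂ] Spinor, IsRealStructure Γ.extend σ →
      ((∃ δ : ι → N → Spinor, IsSpinorField S δ ∧ IsMajorana S σ δ ∧ IsNonzero S δ ∧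
          SolvesKilling11 Γ S g φ C₁ B₂ C₃ α δ) ↔
        ∃ ε : ι → N → Spinor, IsSpinorField S ε ∧ IsMajorana S σ ε ∧ IsNonzero S ε ∧
          SolvesDilatino Γ S φ C₁ B₂ C₃ ε ∧ SolvesGravitino Γ S g φ C₁ B₂ C₃ ε)) := by
  refine ⟨fun δ hδ ε hε => ⟨fun i x hx z => ?_, fun i x hx z hd a => ?_,
    solvesKilling11_iff hφ hC₁ hB₂ hC₃ hα hS hδ hε⟩, fun σ _ => ⟨?_, ?_⟩⟩
  · exact (hS.frameData hφ hC₁ hα hx).gravitino11_vertical_eq_zero_iff Γ hB₂ hC₃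
      (hδ.mdifferentiableAt hS hx) (hε i) z
  · exact (hS.frameData hφ hC₁ hα hx).gravitino11_horizontal_eq_zero_iff Γ hB₂ hC₃
      (hδ.mdifferentiableAt hS hx) (hε i) z hd a
  · rintro ⟨δ, hδ, hm, hn, hk⟩
    exact ⟨_, hδ.smul (contMDiff_exp_div hφ 6), hm.smul _, hn.smul fun x => (Real.exp_pos _).ne',
      (solvesKilling11_iff hφ hC₁ hB₂ hC₃ hα hS hδ fun _ _ => rfl).1 hk⟩
  · rintro ⟨ε, hε, hm, hn, hk⟩
    -- The inverse rescaling δ = e^{-φ/6} ε, written as division of φ by -6.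
    have hδ := hε.smul (contMDiff_exp_div hφ (-6))
    refine ⟨_, hδ, hm.smul _, hn.smul fun x => (Real.exp_pos _).ne',
      (solvesKilling11_iff hφ hC₁ hB₂ hC₃ hα hS hδ fun i x => ?_).2 hk⟩
    rw [smul_smul, ← Real.exp_add]
    ring_nf
    rw [Real.exp_zero, one_smul]
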